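/- **Setting.** Let $f,R:\mathbb R^p\to\mathbb R\cup\{+\infty\}$ be proper, closed and convex, $F:=f+R$, and let $f$ be standard self-concordant: $\operatorname{dom} f$ is open, $f\in C^3(\operatorname{dom} f)$, and for all $x\in\operatorname{dom} f$, $v\in\mathbb R^p$ the function $\varphi(\tau)=f(x+\tau v)$ satisfies $|\varphi'''|\le 2(\varphi'')^{3/2}$ on its domain. For a symmetric positive definite matrix $H(x)$ write $|||u|||_x=(u^\top H(x)u)^{1/2}$ and $|||v|||_x^*=(v^\top H(x)^{-1}v)^{1/2}$; let $\omega(\tau)=\tau-\ln(1+\tau)$ and $\omega_*(\tau)=-\tau-\ln(1-\tau)$. Let $\mathcal X\subseteq\operatorname{dom} f$, let $\delta_0,\delta_3\in[0,1)$, $\delta_1,\delta_2\ge 0$, and let $(\tilde f,g,H)$ be a $(\delta_0,\delta_1,\delta_2,\delta_3)$-local inexact second-order oracle of $f$ on $\mathcal X$: for all $x\in\mathcal X$, $H(x)\succ0$, $|||g(x)-\nabla f(x)|||_x^*\le\delta_2$, $(1-\delta_3)^2\nabla^2f(x)\preceq H(x)\preceq(1+\delta_3)^2\nabla^2f(x)$,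 and every $y$ with $|||y-x|||_x<\frac1{1+\delta_0}$ lies in $\operatorname{dom} f$ and satisfies $$\omega\big((1-\delta_0)|||y-x|||_x\big)\le f(y)-\tilde f(x)-\langle g(x),y-x\rangle\le\omega_*\big((1+\delta_0)|||y-x|||_x\big)+\delta_1 .$$ Let $\delta_4\in[0,1)$ and let $\{x^k\}\subset\mathcal X$, $x^0\in\operatorname{dom}F$, be generated by the inexact proximal Newton algorithm with damped step size: $z^k$ is such that there is $\nu^k\in g(x^k)+H(x^k)(z^k-x^k)+\partial R(z^k)$ with $|||\nu^k|||^*_{x^k}\le\delta_4\lambda_k$, where $\lambda_k:=|||z^k-x^k|||_{x^k}$, and $$x^{k+1}=x^k+\alpha_k(z^k-x^k),\qquad \alpha_k=\frac{1-\delta_4}{(1+\delta_0)(1+\delta_0+(1-\delta_4)\lambda_k)} .$$ **Theorem.** Suppose that $0\le\delta_3,\delta_4\le\delta\le\frac1{100}$ and $\delta_0=\delta$. For every $k$ with $\lambda_k\le\frac1{20}$, $$\lambda_{k+1}\le\tfrac1{10}\big(41\lambda_k^2+125\,\delta\lambda_k+21\,\delta_2\big).$$ Moreover, for every $\varepsilon\in(0,\frac1{20})$,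 if $\lambda_0\le\frac1{20}$, then: (a) (linear rate) if $\delta_2=\frac{5\varepsilon}{32}$, then $\lambda_k\le\varepsilon$ for $k=\lfloor\ln\frac1\varepsilon\rfloor$; (b) (superlinear rate) if $\delta\le\frac14\big(\frac35\big)^{\ln(1/\varepsilon)}$ and $0\le\delta_2\le\frac{37}{20}\big(\frac{11}{50}\big)^{\ln(1/\varepsilon)}$, then $\lambda_k\le\varepsilon$ for $k=\lfloor\log_{3/2}(\ln\frac1\varepsilon)\rfloor$; (c) (quadratic rate) if $\delta\le\frac1{10}\big(\frac{19}{50}\big)^{\ln(1/\varepsilon)}$ and $0\le\delta_2\le\frac15\big(\frac{13}{50}\big)^{\ln(1/\varepsilon)}$, then $\lambda_k\le\varepsilon$ for $k=\lfloor\log_2(\ln\frac1\varepsilon)\rfloor$. In addition (for arbitrary $\delta_0,\delta_3,\delta_4\in[0,1)$), there is an absolute constant $C>0$ such that, for every $k$ with $\lambda_k\le\frac1{4(1+\delta_0)}$, and if $\delta_1\le1$, the set $\partial F(z^k)$ is nonempty and $$\inf_{w\in\partial F(z^k)}|||w|||^*_{x^k}\le C\big(\lambda_k+\sqrt{\delta_1}\big).$$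 Hence, for all $c_1,c_2>0$ there is a constant $K>0$, depending only on $c_1$ and $c_2$, such that for every $\varepsilon>0$ and every $k$, if $\lambda_k\le c_1\varepsilon\le\frac1{4(1+\delta_0)}$ and $\delta_1\le c_2\varepsilon^2\le1$, then $\inf_{w\in\partial F(z^k)}|||w|||^*_{x^k}\le K\varepsilon$. -/

import Mathlib

namespace InexactProxNewton

noncomputable section

/-- The space `ℝ^p` with its Euclidean structure. -/
abbrev Vec (p : ℕ) : Type := EuclideanSpace ℝ (Fin p)

/-- Linear operators (that is, `p × p` matrices) on `ℝ^p`. Between two of them, `≤` is the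
Loewner order. -/
abbrev Op (p : ℕ) : Type := Vec p →L[ℝ] Vec p

/-! ### Extended-valued convex functions

A function `ℝ^p → ℝ ∪ {+∞}` is given by its domain `D` (the set where it is finite) and by a
function `f : ℝ^p → ℝ` whose values on `D` are those of the function; the values of `f` outside
`D` play no role. -/

/-- The function with domain `D` and values `f` is proper, closed and convex. -/
structure ProperClosedConvex {p : ℕ} (D : Set (Vec p)) (f : Vec p → ℝ) : Prop where
  nonempty : D.Nonempty
  convexOn : ConvexOn ℝ D f
  isClosed_epigraph : IsClosed {q : Vec p × ℝ | q.1 ∈ D ∧ f q.1 ≤ q.2}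

/-- The subdifferential at `x` of the function with domain `D` and values `f` (empty for `x`
outside of the domain). -/
def subdifferential {p : ℕ} (D : Set (Vec p)) (f : Vec p → ℝ) (x : Vec p) : Set (Vec p) :=
  {w | x ∈ D ∧ ∀ u ∈ D, f x + inner ℝ w (u - x) ≤ f u}

/-! ### Self-concordance -/

/-- A univariate convex function `φ`, of class `C³` on its open domain `S`, is
`M`-self-concordant. -/
structure SelfConcordantOnLine (M : ℝ) (S : Set ℝ) (φ : ℝ → ℝ) : Prop where
  isOpen : IsOpen S
  convexOn : ConvexOn ℝ S φ
  contDiffOn : ContDiffOn ℝ 3 φ S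
  bound : ∀ t ∈ S, |iteratedDeriv 3 φ t| ≤ M * (iteratedDeriv 2 φ t) ^ (3 / 2 : ℝ)

/-- `f`, of class `C³` on its open domain `D`, is standard self-concordant: all its restrictions
to lines are `2`-self-concordant. -/
structure StandardSelfConcordant {p : ℕ} (D : Set (Vec p)) (f : Vec p → ℝ) : Prop where
  isOpen : IsOpen D
  contDiffOn : ContDiffOn ℝ 3 f D
  onLines : ∀ x ∈ D, ∀ v : Vec p,
    SelfConcordantOnLine 2 {t : ℝ | x + t • v ∈ D} (fun t => f (x + t • v))

/-- The Hessian `∇²f(x)`. -/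
def hessian {p : ℕ} (f : Vec p → ℝ) (x : Vec p) : Op p :=
  fderiv ℝ (gradient f) x

/-! ### Weighted norms -/

/-- `A` is symmetric positive definite. -/
def IsPosDef {p : ℕ} (A : Op p) : Prop :=
  (A : Vec p →ₗ[ℝ] Vec p).IsSymmetric ∧ ∀ u : Vec p, u ≠ 0 → 0 < inner ℝ (A u) u

/-- The weighted norm `(uᵀ A u)^{1/2}`. -/
def weightedNorm {p : ℕ} (A : Op p) (u : Vec p) : ℝ :=
  √(inner ℝ (A u) u)

/-- The dual weighted norm `(vᵀ A⁻¹ v)^{1/2}`. -/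
def dualNorm {p : ℕ} (A : Op p) (v : Vec p) : ℝ :=
  √(inner ℝ (A.inverse v) v)

/-! ### Inexact oracles -/

/-- `ω(τ) = τ - ln(1 + τ)`. -/
def omega (τ : ℝ) : ℝ := τ - Real.log (1 + τ)

/-- `ω_*(τ) = -τ - ln(1 - τ)`. -/
def omegaStar (τ : ℝ) : ℝ := -τ - Real.log (1 - τ)

/-- `(ftil, g, H)` is a `(δ₀, δ₁, δ₂, δ₃)`-local inexact second-order oracle, on the subset `X`
of the domain `D`, of the function with domain `D` and values `f`. -/
structure LocalInexactOracle {p : ℕ} (D : Set (Vec p)) (f : Vec p → ℝ) (X : Set (Vec p))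
    (ftil : Vec p → ℝ) (g : Vec p → Vec p) (H : Vec p → Op p) (δ₀ δ₁ δ₂ δ₃ : ℝ) : Prop where
  delta0_nonneg : 0 ≤ δ₀
  delta0_lt_one : δ₀ < 1
  delta1_nonneg : 0 ≤ δ₁
  delta2_nonneg : 0 ≤ δ₂
  delta3_nonneg : 0 ≤ δ₃
  delta3_lt_one : δ₃ < 1
  subset_dom : X ⊆ D
  posDef : ∀ x ∈ X, IsPosDef (H x)
  mem_dom : ∀ x ∈ X, ∀ y, weightedNorm (H x) (y - x) < 1 / (1 + δ₀) → y ∈ D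
  lower : ∀ x ∈ X, ∀ y, weightedNorm (H x) (y - x) < 1 / (1 + δ₀) →
    omega ((1 - δ₀) * weightedNorm (H x) (y - x)) ≤ f y - ftil x - inner ℝ (g x) (y - x)
  upper : ∀ x ∈ X, ∀ y, weightedNorm (H x) (y - x) < 1 / (1 + δ₀) →
    f y - ftil x - inner ℝ (g x) (y - x) ≤
      omegaStar ((1 + δ₀) * weightedNorm (H x) (y - x)) + δ₁
  gradient_error : ∀ x ∈ X, dualNorm (H x) (g x - gradient f x) ≤ δ₂
  hessian_lower : ∀ x ∈ X, (1 - δ₃) ^ 2 • hessian f x ≤ H x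
  hessian_upper : ∀ x ∈ X, H x ≤ (1 + δ₃) ^ 2 • hessian f x

/-! ### The inexact proximal Newton algorithm -/

/-- The inexact Newton decrement `λ_k`, the weighted norm of `d^k = z^k - x^k` at `x^k`. -/
def decrement {p : ℕ} (H : Vec p → Op p) (x z : ℕ → Vec p) (k : ℕ) : ℝ :=
  weightedNorm (H (x k)) (z k - x k)

/-- The damped step size, as a function of `δ₀`, `δ₄` and of the Newton decrement. -/
def dampedStep (δ₀ δ₄ lam : ℝ) : ℝ :=
  (1 - δ₄) / ((1 + δ₀) * (1 + δ₀ + (1 - δ₄) * lam))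

/-- `(x^k)` and `(z^k)` are generated by the inexact proximal Newton algorithm, with the inexact
gradients `g`, the inexact Hessians `H`, the accuracy `δ₄` of the subproblems and the damped step
size, for the regularizer with domain `DR` and values `R`. -/
structure IsDampedIPNA {p : ℕ} (DR : Set (Vec p)) (R : Vec p → ℝ) (g : Vec p → Vec p)
    (H : Vec p → Op p) (δ₀ δ₄ : ℝ) (x z : ℕ → Vec p) : Prop where
  /-- `z^k` meets the stopping criterion for the quadratic subproblem at `x^k`: some `ν^k` in
  `g(x^k) + H(x^k)(z^k - x^k) + ∂R(z^k)` has dual norm at most `δ₄ λ_k`. -/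
  stopping : ∀ k, ∃ ν : Vec p,
    ν - (g (x k) + H (x k) (z k - x k)) ∈ subdifferential DR R (z k) ∧
      dualNorm (H (x k)) ν ≤ δ₄ * weightedNorm (H (x k)) (z k - x k)
  step : ∀ k, x (k + 1) = x k + dampedStep δ₀ δ₄ (decrement H x z k) • (z k - x k)

/-- The residual of `z` as a minimizer of `F = f + R`, the infimum of the dual norms (with weight
`A`) of the subgradients of `F` at `z`. -/
def subgradientResidual {p : ℕ} (Df : Set (Vec p)) (f : Vec p → ℝ) (DR : Set (Vec p))
    (R : Vec p → ℝ) (A : Op p) (z : Vec p) : ℝ :=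
  sInf (dualNorm A '' subdifferential (Df ∩ DR) (fun u => f u + R u) z)

end

end InexactProxNewton

open InexactProxNewton

/-!
Along lines, self-concordance says `|D³f(x)[v, v, v]| ≤ 2 D²f(x)[v, v]^{3/2}`. The polar form of a
cubic form obeys the same bound as the cubic form itself, so `|D³f(x)[h, v, v]|` is at most
`2 D²f(x)[h, h]^{1/2} D²f(x)[v, v]`, and integrating this differential inequality compares the
Hessians, hence the matrices `H`, at nearby points.

Monotonicity of `∂R` between the optimality conditions of two consecutive subproblems bounds the
new direction `d'` by `⟪b - H' d', d' - w⟫ ≥ 0`, where `w = (1 - α) d` and `b` collects the errors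
of the oracle and of the subproblems and the linearization error of the gradient. Completing the
square gives `‖d'‖² ≤ ‖w‖² + ‖b‖*²`, a recursion for the decrements only. The superlinear and
quadratic rates follow by comparing it with sequences `q * exp (-B ^ k)`, for `B = 3 / 2` and
`B = 2`.

For the residual, testing convexity of `f` on points at distance of order `λ + √δ₁` turns the
oracle bounds, which involve function values only, into a bound on `∇f(z) - g(x)`.
-/

namespace InexactProxNewton

section BinaryCubics

open Real

/-- The binary cubic form with coefficients `c₀, c₁, c₂, c₃`; the binomial normalization makes
`c₁` the value at `(e₁, e₁, e₂)` of the associated symmetric trilinear form. -/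
def binaryCubic (c₀ c₁ c₂ c₃ a b : ℝ) : ℝ :=
  c₀ * a ^ 3 + 3 * c₁ * a ^ 2 * b + 3 * c₂ * a * b ^ 2 + c₃ * b ^ 3

variable {c₀ c₁ c₂ c₃ M : ℝ}

/-- The nodes are the angles `u`, `u + π / 3` and `u - π / 3`, where `(c, s) = (cos u, sin u)`
and `w = sin (π / 3)`. -/
lemma binaryCubic_interpolation (c₀ c₁ c₂ c₃ : ℝ) {c s w : ℝ} (hcs : c ^ 2 + s ^ 2 = 1)
    (hw : w ^ 2 = 3 / 4) :
    (4 * c ^ 3 - 3 * c) * c₀ + (3 * s - 4 * s ^ 3) * c₁ =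
      ((4 * c ^ 2 - 1) / 3) ^ 2 * binaryCubic c₀ c₁ c₂ c₃ c s -
      ((4 * (c / 2 - w * s) ^ 2 - 1) / 3) ^ 2 *
        binaryCubic c₀ c₁ c₂ c₃ (c / 2 - w * s) (s / 2 + w * c) -
      ((4 * (c / 2 + w * s) ^ 2 - 1) / 3) ^ 2 *
        binaryCubic c₀ c₁ c₂ c₃ (c / 2 + w * s) (s / 2 - w * c) := by
  have hs2 : s ^ 2 = 1 - c ^ 2 := by linarith
  have hs3 : s ^ 3 = s * (1 - c ^ 2) := by rw [← hs2]; ring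
  have hs4 : s ^ 4 = (1 - c ^ 2) ^ 2 := by rw [← hs2]; ring
  have hs5 : s ^ 5 = s * (1 - c ^ 2) ^ 2 := by rw [← hs2]; ring
  have hs6 : s ^ 6 = (1 - c ^ 2) ^ 3 := by rw [← hs2]; ring
  have hs7 : s ^ 7 = s * (1 - c ^ 2) ^ 3 := by rw [← hs2]; ring
  have hw4 : w ^ 4 = (3 / 4) ^ 2 := by rw [← hw]; ring
  have hw6 : w ^ 6 = (3 / 4) ^ 3 := by rw [← hw]; ring
  simp only [binaryCubic]
  ring_nf
  simp only [hw, hw4, hw6, hs2, hs3, hs4, hs5, hs6, hs7]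
  ring

lemma interpolation_weights_sum {c s w : ℝ} (hcs : c ^ 2 + s ^ 2 = 1) (hw : w ^ 2 = 3 / 4) :
    ((4 * c ^ 2 - 1) / 3) ^ 2 + ((4 * (c / 2 - w * s) ^ 2 - 1) / 3) ^ 2 +
      ((4 * (c / 2 + w * s) ^ 2 - 1) / 3) ^ 2 = 1 := by
  have hs2 : s ^ 2 = 1 - c ^ 2 := by linarith
  have hs4 : s ^ 4 = (1 - c ^ 2) ^ 2 := by rw [← hs2]; ring
  have hw4 : w ^ 4 = (3 / 4) ^ 2 := by rw [← hw]; ring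
  ring_nf
  simp only [hw, hw4, hs2, hs4]
  ring

lemma abs_cos_three_mul_add_sin_three_mul_le
    (h : ∀ a b : ℝ, a ^ 2 + b ^ 2 = 1 → |binaryCubic c₀ c₁ c₂ c₃ a b| ≤ M) (u : ℝ) :
    |cos (3 * u) * c₀ + sin (3 * u) * c₁| ≤ M := by
  have hcs : cos u ^ 2 + sin u ^ 2 = 1 := cos_sq_add_sin_sq u
  have hw : (√3 / 2) ^ 2 = 3 / 4 := by rw [div_pow, sq_sqrt (by norm_num)]; norm_num
  rw [cos_three_mul, sin_three_mul, binaryCubic_interpolation c₀ c₁ c₂ c₃ hcs hw]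
  have hsum := interpolation_weights_sum hcs hw
  generalize cos u = c, sin u = s, √3 / 2 = w at *
  have h₀ := h _ _ hcs
  have h₁ := h (c / 2 - w * s) (s / 2 + w * c) (by linear_combination (1 / 4 + w ^ 2) * hcs + hw)
  have h₂ := h (c / 2 + w * s) (s / 2 - w * c) (by linear_combination (1 / 4 + w ^ 2) * hcs + hw)
  have key : ∀ r t : ℝ, |t| ≤ M → |r ^ 2 * t| ≤ r ^ 2 * M := fun r t ht => by
    rw [abs_mul, abs_of_nonneg (sq_nonneg r)]
    gcongr
  calc _ ≤ _ := (abs_sub _ _).trans (add_le_add_left (abs_sub _ _) _)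
    _ ≤ _ := add_le_add_three (key _ _ h₀) (key _ _ h₁) (key _ _ h₂)
    _ = M := by rw [← add_mul, ← add_mul, hsum, one_mul]

lemma abs_add_mul_le_of_unit_circle
    (h : ∀ a b : ℝ, a ^ 2 + b ^ 2 = 1 → |binaryCubic c₀ c₁ c₂ c₃ a b| ≤ M) (y z : ℝ) :
    |y * c₀ + z * c₁| ≤ M * √(y ^ 2 + z ^ 2) := by
  obtain ⟨r, θ, hr, rfl, rfl⟩ : ∃ r θ : ℝ, 0 ≤ r ∧ r * cos θ = y ∧ r * sin θ = z :=
    ⟨_, _, norm_nonneg _, Complex.norm_mul_cos_arg ⟨y, z⟩, Complex.norm_mul_sin_arg ⟨y, z⟩⟩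
  have hθ := abs_cos_three_mul_add_sin_three_mul_le h (θ / 3)
  rw [mul_div_cancel₀ _ three_ne_zero] at hθ
  calc |r * cos θ * c₀ + r * sin θ * c₁| = r * |cos θ * c₀ + sin θ * c₁| := by
        rw [mul_assoc, mul_assoc, ← mul_add, abs_mul, abs_of_nonneg hr]
    _ ≤ r * M := by gcongr
    _ = M * √((r * cos θ) ^ 2 + (r * sin θ) ^ 2) := by
        rw [mul_pow, mul_pow, ← mul_add, cos_sq_add_sin_sq, mul_one, sqrt_sq hr, mul_comm]

/-- `x, y, z` are the entries of the Cholesky factor of the quadratic form. -/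
lemma abs_polar_le_of_cholesky {x y z : ℝ} (hx : 0 < x) (hz : 0 < z)
    (h : ∀ a b : ℝ, |binaryCubic c₀ c₁ c₂ c₃ a b| ≤ M * √((x * a + y * b) ^ 2 + (z * b) ^ 2) ^ 3) :
    |c₁| ≤ M * (x ^ 2 * √(y ^ 2 + z ^ 2)) := by
  have hx' := hx.ne'
  have hz' := hz.ne'
  obtain ⟨q, hq⟩ : ∃ q, q = -(y / (x * z)) := ⟨_, rfl⟩
  have hunit : ∀ a b : ℝ, a ^ 2 + b ^ 2 = 1 →
      |binaryCubic (c₀ / x ^ 3) (c₀ * q / x ^ 2 + c₁ / (x ^ 2 * z))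
        (c₀ * q ^ 2 / x + 2 * c₁ * q / (x * z) + c₂ / (x * z ^ 2))
        (c₀ * q ^ 3 + 3 * c₁ * q ^ 2 / z + 3 * c₂ * q / z ^ 2 + c₃ / z ^ 3) a b| ≤ M := by
    intro a b hab
    have hline : x * (a / x + q * b) + y * (b / z) = a := by rw [hq]; field_simp; ring
    convert h (a / x + q * b) (b / z) using 1
    · simp only [binaryCubic]; field_simp; ring_nf
    · rw [hline, mul_div_cancel₀ b hz', hab]; simp
  have hc₁ : y * (c₀ / x ^ 3) + z * (c₀ * q / x ^ 2 + c₁ / (x ^ 2 * z)) = c₁ / x ^ 2 := by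
    rw [hq]; field_simp; ring
  have := abs_add_mul_le_of_unit_circle hunit y z
  rw [hc₁, abs_div, abs_of_pos (pow_pos hx 2), div_le_iff₀ (pow_pos hx 2)] at this
  linarith

lemma abs_polar_le_of_posDef {q₀ q₁ q₂ : ℝ} (hq₀ : 0 < q₀) (hdisc : q₁ ^ 2 < q₀ * q₂)
    (h : ∀ a b : ℝ, |binaryCubic c₀ c₁ c₂ c₃ a b| ≤
      M * √(q₀ * a ^ 2 + 2 * q₁ * a * b + q₂ * b ^ 2) ^ 3) : |c₁| ≤ M * (q₀ * √q₂) := by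
  obtain ⟨x, hx, rfl⟩ : ∃ x, 0 < x ∧ x ^ 2 = q₀ := ⟨√q₀, sqrt_pos.2 hq₀, sq_sqrt hq₀.le⟩
  obtain ⟨y, rfl⟩ : ∃ y, x * y = q₁ := ⟨q₁ / x, mul_div_cancel₀ _ hx.ne'⟩
  have hpos : 0 < q₂ - y ^ 2 := by
    rw [mul_pow] at hdisc
    linarith [lt_of_mul_lt_mul_left hdisc (sq_nonneg x)]
  obtain ⟨z, hz, hz2⟩ : ∃ z, 0 < z ∧ z ^ 2 = q₂ - y ^ 2 :=
    ⟨√(q₂ - y ^ 2), sqrt_pos.2 hpos, sq_sqrt hpos.le⟩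
  obtain rfl : q₂ = y ^ 2 + z ^ 2 := by linarith
  refine abs_polar_le_of_cholesky hx hz fun a b => (h a b).trans_eq ?_
  ring_nf

lemma abs_polar_le {q₀ q₁ q₂ : ℝ} (hM : 0 ≤ M)
    (hq : ∀ a b : ℝ, 0 ≤ q₀ * a ^ 2 + 2 * q₁ * a * b + q₂ * b ^ 2)
    (h : ∀ a b : ℝ, |binaryCubic c₀ c₁ c₂ c₃ a b| ≤
      M * √(q₀ * a ^ 2 + 2 * q₁ * a * b + q₂ * b ^ 2) ^ 3) : |c₁| ≤ M * (q₀ * √q₂) := by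
  have hq₀ : 0 ≤ q₀ := by simpa using hq 1 0
  have hq₂ : 0 ≤ q₂ := by simpa using hq 0 1
  have hdisc : q₁ ^ 2 ≤ q₀ * q₂ := by
    have := discrim_le_zero (a := q₀) (b := 2 * q₁) (c := q₂) fun x => by linarith [hq x 1]
    rw [discrim] at this
    linarith
  have hperturbed : ∀ ε : ℝ, 0 < ε → |c₁| ≤ M * ((q₀ + ε) * √(q₂ + ε)) := fun ε hε =>
    abs_polar_le_of_posDef (q₁ := q₁) (by linarith) (by nlinarith) fun a b => (h a b).trans <| by
      gcongr <;> linarith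
  have hlim : Filter.Tendsto (fun ε : ℝ => M * ((q₀ + ε) * √(q₂ + ε))) (nhdsWithin 0 (Set.Ioi 0))
      (nhds (M * (q₀ * √q₂))) := by
    have : Continuous fun ε : ℝ => M * ((q₀ + ε) * √(q₂ + ε)) := by fun_prop
    simpa using (this.tendsto 0).mono_left nhdsWithin_le_nhds
  exact ge_of_tendsto hlim (by filter_upwards [self_mem_nhdsWithin] using hperturbed)

end BinaryCubics

section HigherDerivatives

variable {E : Type*} [NormedAddCommGroup E] [NormedSpace ℝ E] {f : E → ℝ} {x : E}

/-- The second derivative of `f` at `x`, as a bilinear form. -/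
noncomputable def hessForm (f : E → ℝ) (x u v : E) : ℝ :=
  fderiv ℝ (fderiv ℝ f) x u v

/-- The third derivative of `f` at `x`, as a trilinear form; the direction of the last
differentiation comes first. -/
noncomputable def thirdForm (f : E → ℝ) (x u v w : E) : ℝ :=
  fderiv ℝ (fderiv ℝ (fderiv ℝ f)) x u v w

lemma hessForm_symm (hf : ContDiffAt ℝ 2 f x) (u v : E) : hessForm f x u v = hessForm f x v u :=
  hf.isSymmSndFDerivAt (by simp) u v

lemma hasDerivAt_line (x h : E) (t : ℝ) : HasDerivAt (fun s : ℝ => x + s • h) h t := by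
  simpa using ((hasDerivAt_id t).smul_const h).const_add x

lemma hasDerivAt_fderiv_line {h : E} {t : ℝ} (hf : ContDiffAt ℝ 2 f (x + t • h)) (v : E) :
    HasDerivAt (fun s : ℝ => fderiv ℝ f (x + s • h) v) (hessForm f (x + t • h) h v) t := by
  have hdiff : DifferentiableAt ℝ (fderiv ℝ f) (x + t • h) :=
    (hf.fderiv_right (m := 1) (by norm_num)).differentiableAt (by norm_num)
  have hline := hdiff.hasFDerivAt.comp_hasDerivAt t (hasDerivAt_line x h t)
  simpa [hessForm] using hline.clm_apply (hasDerivAt_const t v)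

lemma hasDerivAt_hessForm_line {h : E} {t : ℝ} (hf : ContDiffAt ℝ 3 f (x + t • h)) (v w : E) :
    HasDerivAt (fun s : ℝ => hessForm f (x + s • h) v w) (thirdForm f (x + t • h) h v w) t := by
  have hdiff : DifferentiableAt ℝ (fderiv ℝ (fderiv ℝ f)) (x + t • h) :=
    ((hf.fderiv_right (m := 2) (by norm_num)).fderiv_right (m := 1)
      (by norm_num)).differentiableAt (by norm_num)
  have hline : HasDerivAt (fun s : ℝ => fderiv ℝ (fderiv ℝ f) (x + s • h))
      (fderiv ℝ (fderiv ℝ (fderiv ℝ f)) (x + t • h) h) t :=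
    HasFDerivAt.comp_hasDerivAt (E := E →L[ℝ] E →L[ℝ] ℝ) (f := fun s : ℝ => x + s • h) t
      hdiff.hasFDerivAt (hasDerivAt_line x h t)
  simpa [hessForm, thirdForm] using
    (hline.clm_apply (hasDerivAt_const t v)).clm_apply (hasDerivAt_const t w)

lemma thirdForm_swap_left (hf : ContDiffAt ℝ 3 f x) (u v w : E) :
    thirdForm f x u v w = thirdForm f x v u w :=
  DFunLike.congr_fun
    ((hf.fderiv_right (m := 2) (by norm_num)).isSymmSndFDerivAt (by simp) u v) w

lemma thirdForm_swap_right (hf : ContDiffAt ℝ 3 f x) (u v w : E) :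
    thirdForm f x u v w = thirdForm f x u w v := by
  have hf₀ : ContDiffAt ℝ 3 f (x + (0 : ℝ) • u) := by simpa using hf
  have hsymm : (fun s : ℝ => hessForm f (x + s • u) v w) =ᶠ[nhds 0]
      fun s : ℝ => hessForm f (x + s • u) w v := by
    have hline := (hasDerivAt_line x u 0).continuousAt.eventually (hf₀.eventually (by simp))
    filter_upwards [hline] with s hs using hessForm_symm (hs.of_le (by norm_num)) v w
  simpa using ((hasDerivAt_hessForm_line hf₀ v w).congr_of_eventuallyEq hsymm.symm).unique
    (hasDerivAt_hessForm_line hf₀ w v)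

lemma inner_hessian {p : ℕ} {f : Vec p → ℝ} {x : Vec p} (hf : ContDiffAt ℝ 2 f x) (u v : Vec p) :
    inner ℝ (hessian f x u) v = hessForm f x u v := by
  have hdiff : DifferentiableAt ℝ (fderiv ℝ f) x :=
    (hf.fderiv_right (m := 1) (by norm_num)).differentiableAt (by norm_num)
  let riesz : (Vec p →L[ℝ] ℝ) →L[ℝ] Vec p := LinearMap.toContinuousLinearMap
    { toFun := (InnerProductSpace.toDual ℝ (Vec p)).symm
      map_add' := map_add _
      map_smul' := fun c u => by simp }
  have hgrad : HasFDerivAt (gradient f) (riesz.comp (fderiv ℝ (fderiv ℝ f) x)) x :=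
    riesz.hasFDerivAt.comp x hdiff.hasFDerivAt
  rw [hessian, hgrad.fderiv, hessForm]
  exact InnerProductSpace.toDual_symm_apply

end HigherDerivatives

namespace StandardSelfConcordant

variable {p : ℕ} {D : Set (Vec p)} {f : Vec p → ℝ} {x : Vec p}

lemma contDiffAt (hsc : StandardSelfConcordant D f) (hx : x ∈ D) : ContDiffAt ℝ 3 f x :=
  hsc.contDiffOn.contDiffAt (hsc.isOpen.mem_nhds hx)

lemma contDiffAt_two (hsc : StandardSelfConcordant D f) (hx : x ∈ D) : ContDiffAt ℝ 2 f x :=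
  (hsc.contDiffAt hx).of_le (by norm_num)

lemma hasDerivAt_comp_line (hsc : StandardSelfConcordant D f) (v : Vec p) {t : ℝ}
    (ht : x + t • v ∈ D) :
    HasDerivAt (fun s : ℝ => f (x + s • v)) (fderiv ℝ f (x + t • v) v) t :=
  ((hsc.contDiffAt ht).differentiableAt (by norm_num)).hasFDerivAt.comp_hasDerivAt t
    (hasDerivAt_line x v t)

lemma deriv_deriv_line (hsc : StandardSelfConcordant D f) (v : Vec p) {t : ℝ}
    (ht : x + t • v ∈ D) :
    deriv (deriv fun s : ℝ => f (x + s • v)) t = hessForm f (x + t • v) v v := by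
  have hderiv : deriv (fun s : ℝ => f (x + s • v)) =ᶠ[nhds t]
      fun s => fderiv ℝ f (x + s • v) v := by
    filter_upwards [(hasDerivAt_line x v t).continuousAt (hsc.isOpen.mem_nhds ht)] with s hs
      using (hsc.hasDerivAt_comp_line v hs).deriv
  rw [hderiv.deriv_eq, (hasDerivAt_fderiv_line (hsc.contDiffAt_two ht) v).deriv]

lemma deriv_deriv_deriv_line (hsc : StandardSelfConcordant D f) (v : Vec p) {t : ℝ}
    (ht : x + t • v ∈ D) :
    deriv (deriv (deriv fun s : ℝ => f (x + s • v))) t = thirdForm f (x + t • v) v v v := by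
  have hderiv : deriv (deriv fun s : ℝ => f (x + s • v)) =ᶠ[nhds t]
      fun s => hessForm f (x + s • v) v v := by
    filter_upwards [(hasDerivAt_line x v t).continuousAt (hsc.isOpen.mem_nhds ht)] with s hs
      using hsc.deriv_deriv_line v hs
  rw [hderiv.deriv_eq, (hasDerivAt_hessForm_line (hsc.contDiffAt ht) v v).deriv]

lemma hessForm_nonneg (hsc : StandardSelfConcordant D f) (hx : x ∈ D) (v : Vec p) :
    0 ≤ hessForm f x v v := by
  have h₀ : x + (0 : ℝ) • v ∈ D := by simpa using hx
  have hline := hsc.onLines x hx v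
  have hmono : MonotoneOn (deriv fun s : ℝ => f (x + s • v)) {t : ℝ | x + t • v ∈ D} :=
    hline.convexOn.monotoneOn_deriv fun t ht => (hsc.hasDerivAt_comp_line v ht).differentiableAt
  have hnonneg := hmono.derivWithin_nonneg (x := 0)
  rw [derivWithin_of_isOpen hline.isOpen h₀, hsc.deriv_deriv_line v h₀] at hnonneg
  simpa using hnonneg

lemma abs_thirdForm_diag_le (hsc : StandardSelfConcordant D f) (hx : x ∈ D) (v : Vec p) :
    |thirdForm f x v v v| ≤ 2 * √(hessForm f x v v) ^ 3 := by
  have h₀ : x + (0 : ℝ) • v ∈ D := by simpa using hx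
  have hbound := (hsc.onLines x hx v).bound 0 h₀
  simp only [iteratedDeriv_eq_iterate, Function.iterate_succ, Function.iterate_zero,
    Function.comp_apply, id] at hbound
  rw [hsc.deriv_deriv_line v h₀, hsc.deriv_deriv_deriv_line v h₀, zero_smul, add_zero] at hbound
  convert hbound using 2
  rw [Real.sqrt_eq_rpow, ← Real.rpow_mul_natCast (hsc.hessForm_nonneg hx v)]
  norm_num

lemma abs_thirdForm_le (hsc : StandardSelfConcordant D f) (hx : x ∈ D) (h v : Vec p) :
    |thirdForm f x h v v| ≤ 2 * (hessForm f x v v * √(hessForm f x h h)) := by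
  have hf := hsc.contDiffAt hx
  have hquad : ∀ a b : ℝ, hessForm f x v v * a ^ 2 + 2 * hessForm f x v h * a * b
      + hessForm f x h h * b ^ 2 = hessForm f x (a • v + b • h) (a • v + b • h) := by
    intro a b
    have hsymm := hessForm_symm (hsc.contDiffAt_two hx) h v
    simp only [hessForm, map_add, map_smul, add_apply, smul_apply, smul_eq_mul] at hsymm ⊢
    rw [hsymm]; ring
  have hcubic : ∀ a b : ℝ, binaryCubic (thirdForm f x v v v) (thirdForm f x h v v)
      (thirdForm f x v h h) (thirdForm f x h h h) a b
      = thirdForm f x (a • v + b • h) (a • v + b • h) (a • v + b • h) := by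
    intro a b
    have hvhv := thirdForm_swap_left hf v h v
    have hvvh := thirdForm_swap_right hf v v h
    have hhvh := thirdForm_swap_left hf v h h
    have hhhv := thirdForm_swap_right hf h v h
    simp only [binaryCubic, thirdForm, map_add, map_smul, add_apply, smul_apply, smul_eq_mul]
      at hvhv hvvh hhvh hhhv ⊢
    rw [hvvh, hvhv, ← hhhv, ← hhvh]; ring
  refine abs_polar_le (c₀ := thirdForm f x v v v) (c₂ := thirdForm f x v h h)
    (c₃ := thirdForm f x h h h) (q₁ := hessForm f x v h) zero_le_two
    (fun a b => hquad a b ▸ hsc.hessForm_nonneg hx _) fun a b => ?_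
  rw [hquad, hcubic]
  exact hsc.abs_thirdForm_diag_le hx _

end StandardSelfConcordant

section DifferentialInequalities

open Set Real

variable {b r t : ℝ}

lemma monotoneOn_Icc_of_hasDerivAt {φ φ' : ℝ → ℝ} (h : ∀ t ∈ Icc 0 b, HasDerivAt φ (φ' t) t)
    (h' : ∀ t ∈ Icc 0 b, 0 ≤ φ' t) : MonotoneOn φ (Icc 0 b) :=
  monotoneOn_of_hasDerivWithinAt_nonneg (convex_Icc 0 b)
    (fun t ht => (h t ht).continuousAt.continuousWithinAt)
    (fun t ht => (h t (interior_subset ht)).hasDerivWithinAt)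
    fun t ht => h' t (interior_subset ht)

lemma sqrt_le_div_of_deriv_le {q q' : ℝ → ℝ} (hq : ∀ s ∈ Icc 0 b, 0 ≤ q s)
    (hderiv : ∀ s ∈ Icc 0 b, HasDerivAt q (q' s) s)
    (hbound : ∀ s ∈ Icc 0 b, q' s ≤ 2 * √(q s) ^ 3) (hr : √(q 0) < r) (hbr : b * r < 1)
    (ht : t ∈ Icc 0 b) : √(q t) ≤ r / (1 - t * r) := by
  have hr₀ : 0 < r := (sqrt_nonneg _).trans_lt hr
  -- Adding `η` keeps `q + η` positive and lets `1 / √(q + η)` start at exactly `1 / r`.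
  obtain ⟨η, hη, hη₀⟩ : ∃ η, 0 < η ∧ q 0 + η = r ^ 2 :=
    ⟨r ^ 2 - q 0, sub_pos.2 (lt_sq_of_sqrt_lt hr), add_sub_cancel _ _⟩
  have hpos : ∀ s ∈ Icc 0 b, 0 < q s + η := fun s hs => by linarith [hq s hs]
  have hmono : MonotoneOn (fun s => (√(q s + η))⁻¹ + s) (Icc 0 b) := by
    refine monotoneOn_Icc_of_hasDerivAt (fun s hs =>
      ((((hderiv s hs).add_const η).sqrt (hpos s hs).ne').inv
        (sqrt_pos.2 (hpos s hs)).ne').add (hasDerivAt_id s)) fun s hs => ?_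
    have hS : 0 < √(q s + η) := sqrt_pos.2 (hpos s hs)
    have hle : q' s / (2 * √(q s + η)) / √(q s + η) ^ 2 ≤ 1 := by
      rw [div_div, div_le_one (by positivity)]
      calc q' s ≤ 2 * √(q s) ^ 3 := hbound s hs
        _ ≤ 2 * √(q s + η) ^ 3 := by gcongr; linarith
        _ = 2 * √(q s + η) * √(q s + η) ^ 2 := by ring
    rw [neg_div]
    linarith
  have hinv : r⁻¹ - t ≤ (√(q t + η))⁻¹ := by
    have := hmono ⟨le_rfl, ht.1.trans ht.2⟩ ht ht.1
    simp only [hη₀, sqrt_sq hr₀.le] at this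
    linarith
  have htr : 0 < 1 - t * r := by nlinarith [ht.2]
  have hinv₀ : r⁻¹ - t = (1 - t * r) / r := by field_simp
  calc √(q t) ≤ √(q t + η) := by gcongr; linarith
    _ = ((√(q t + η))⁻¹)⁻¹ := (inv_inv _).symm
    _ ≤ (r⁻¹ - t)⁻¹ := inv_anti₀ (by rw [hinv₀]; positivity) hinv
    _ = r / (1 - t * r) := by rw [hinv₀, inv_div]

lemma sq_mul_le_of_abs_deriv_le {g g' : ℝ → ℝ} (hderiv : ∀ s ∈ Icc 0 b, HasDerivAt g (g' s) s)
    (hpos : ∀ s ∈ Icc 0 b, 0 < 1 - s * r)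
    (hbound : ∀ s ∈ Icc 0 b, |g' s| ≤ 2 * (g s * (r / (1 - s * r)))) (ht : t ∈ Icc 0 b) :
    (1 - t * r) ^ 2 * g 0 ≤ g t ∧ (1 - t * r) ^ 2 * g t ≤ g 0 := by
  have h₀ : (0 : ℝ) ∈ Icc 0 b := ⟨le_rfl, ht.1.trans ht.2⟩
  have hbound' : ∀ s ∈ Icc 0 b, |g' s * (1 - s * r)| ≤ 2 * r * g s := fun s hs => by
    rw [abs_mul, abs_of_pos (hpos s hs), ← le_div_iff₀ (hpos s hs)]
    exact (hbound s hs).trans_eq (by ring)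
  have hfactor : ∀ s : ℝ, HasDerivAt (fun s => (1 - s * r) ^ 2) (-(2 * r * (1 - s * r))) s :=
    fun s => ((((hasDerivAt_id s).mul_const r).const_sub 1).pow 2).congr_deriv (by simp; ring)
  constructor
  · have hmono : MonotoneOn (fun s => g s / (1 - s * r) ^ 2) (Icc 0 b) := by
      refine monotoneOn_Icc_of_hasDerivAt (fun s hs =>
        (hderiv s hs).div (hfactor s) (pow_ne_zero 2 (hpos s hs).ne')) fun s hs => ?_
      refine div_nonneg ?_ (by positivity)
      nlinarith [neg_le_of_abs_le (hbound' s hs), hpos s hs]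
    have := hmono h₀ ht ht.1
    simp only [zero_mul, sub_zero, one_pow, div_one, le_div_iff₀ (pow_pos (hpos t ht) 2)] at this
    linarith
  · have hmono : MonotoneOn (fun s => -(g s * (1 - s * r) ^ 2)) (Icc 0 b) := by
      refine monotoneOn_Icc_of_hasDerivAt
        (fun s hs => ((hderiv s hs).mul (hfactor s)).neg) fun s hs => ?_
      nlinarith [le_of_abs_le (hbound' s hs), hpos s hs]
    have := hmono h₀ ht ht.1
    simp only [zero_mul, sub_zero, one_pow, mul_one] at this
    linarith

end DifferentialInequalities

namespace StandardSelfConcordant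

open Set Real

variable {p : ℕ} {D : Set (Vec p)} {f : Vec p → ℝ} {x h : Vec p} {r t : ℝ}

lemma hessForm_line_bounds_of_lt (hsc : StandardSelfConcordant D f)
    (hseg : ∀ t ∈ Icc (0 : ℝ) 1, x + t • h ∈ D) (hr : √(hessForm f x h h) < r) (hr1 : r < 1)
    (ht : t ∈ Icc (0 : ℝ) 1) (v : Vec p) :
    (1 - t * r) ^ 2 * hessForm f x v v ≤ hessForm f (x + t • h) v v ∧
      (1 - t * r) ^ 2 * hessForm f (x + t • h) v v ≤ hessForm f x v v := by
  have hderiv (w : Vec p) : ∀ s ∈ Icc (0 : ℝ) 1, HasDerivAt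
      (fun s => hessForm f (x + s • h) w w) (thirdForm f (x + s • h) h w w) s :=
    fun s hs => hasDerivAt_hessForm_line (hsc.contDiffAt (hseg s hs)) w w
  have hlocal : ∀ s ∈ Icc (0 : ℝ) 1, √(hessForm f (x + s • h) h h) ≤ r / (1 - s * r) :=
    fun s hs => sqrt_le_div_of_deriv_le (fun s hs => hsc.hessForm_nonneg (hseg s hs) h)
      (hderiv h) (fun s hs => (le_abs_self _).trans (hsc.abs_thirdForm_diag_le (hseg s hs) h))
      (by simpa using hr) (by linarith) hs
  have hr₀ : 0 < r := (sqrt_nonneg _).trans_lt hr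
  simpa using sq_mul_le_of_abs_deriv_le (hderiv v) (fun s hs => by nlinarith [hs.2])
    (fun s hs => (hsc.abs_thirdForm_le (hseg s hs) h v).trans <| by
      have := hsc.hessForm_nonneg (hseg s hs) v
      gcongr
      exact hlocal s hs) ht

lemma hessForm_line_bounds (hsc : StandardSelfConcordant D f)
    (hseg : ∀ t ∈ Icc (0 : ℝ) 1, x + t • h ∈ D) (hr : √(hessForm f x h h) ≤ r) (hr1 : r < 1)
    (ht : t ∈ Icc (0 : ℝ) 1) (v : Vec p) :
    (1 - t * r) ^ 2 * hessForm f x v v ≤ hessForm f (x + t • h) v v ∧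
      (1 - t * r) ^ 2 * hessForm f (x + t • h) v v ≤ hessForm f x v v := by
  have hlim : ∀ c : ℝ, Filter.Tendsto (fun s : ℝ => (1 - t * s) ^ 2 * c)
      (nhdsWithin r (Ioi r)) (nhds ((1 - t * r) ^ 2 * c)) := fun c => by
    have : Continuous fun s : ℝ => (1 - t * s) ^ 2 * c := by fun_prop
    exact (this.tendsto r).mono_left nhdsWithin_le_nhds
  have hlt : ∀ᶠ s in nhdsWithin r (Ioi r), r < s ∧ s < 1 := Ioo_mem_nhdsGT hr1
  exact ⟨le_of_tendsto (hlim _) (hlt.mono fun s hs =>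
      (hsc.hessForm_line_bounds_of_lt hseg (hr.trans_lt hs.1) hs.2 ht v).1),
    le_of_tendsto (hlim _) (hlt.mono fun s hs =>
      (hsc.hessForm_line_bounds_of_lt hseg (hr.trans_lt hs.1) hs.2 ht v).2)⟩

end StandardSelfConcordant

section WeightedNorms

variable {p : ℕ} {A B : Op p}

lemma weightedNorm_nonneg (A : Op p) (u : Vec p) : 0 ≤ weightedNorm A u := Real.sqrt_nonneg _

lemma dualNorm_nonneg (A : Op p) (v : Vec p) : 0 ≤ dualNorm A v := Real.sqrt_nonneg _

lemma weightedNorm_smul (A : Op p) (c : ℝ) (u : Vec p) :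
    weightedNorm A (c • u) = |c| * weightedNorm A u := by
  rw [weightedNorm, map_smul, real_inner_smul_left, real_inner_smul_right, ← mul_assoc,
    Real.sqrt_mul (mul_self_nonneg c), Real.sqrt_mul_self_eq_abs, weightedNorm]

lemma dualNorm_neg (A : Op p) (v : Vec p) : dualNorm A (-v) = dualNorm A v := by
  rw [dualNorm, map_neg, inner_neg_neg, dualNorm]

namespace IsPosDef

lemma inner_comm (hA : IsPosDef A) (u v : Vec p) : inner ℝ (A u) v = inner ℝ (A v) u :=
  (hA.1 u v).trans (real_inner_comm _ _)

lemma inner_self_nonneg (hA : IsPosDef A) (u : Vec p) : 0 ≤ inner ℝ (A u) u := by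
  rcases eq_or_ne u 0 with rfl | hu
  · simp
  · exact (hA.2 u hu).le

lemma weightedNorm_sq (hA : IsPosDef A) (u : Vec p) : weightedNorm A u ^ 2 = inner ℝ (A u) u :=
  Real.sq_sqrt (hA.inner_self_nonneg u)

lemma eq_zero_of_weightedNorm_eq_zero (hA : IsPosDef A) {u : Vec p}
    (h : weightedNorm A u = 0) : u = 0 := by
  by_contra hu
  exact (hA.2 u hu).ne' (by rw [← hA.weightedNorm_sq, h, zero_pow two_ne_zero])

lemma apply_inverse (hA : IsPosDef A) (v : Vec p) : A (A.inverse v) = v := by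
  have hinj : Function.Injective (A : Vec p →ₗ[ℝ] Vec p) := by
    refine (injective_iff_map_eq_zero _).2 fun u hu => ?_
    by_contra h₀
    have hpos := hA.2 u h₀
    rw [show A u = 0 from hu, inner_zero_left] at hpos
    exact hpos.false
  have hA' : ((LinearEquiv.ofInjectiveEndo _ hinj).toContinuousLinearEquiv : Op p) = A := rfl
  rw [← hA', ContinuousLinearMap.inverse_equiv]
  exact ContinuousLinearEquiv.apply_symm_apply _ v

lemma dualNorm_eq (hA : IsPosDef A) (v : Vec p) :
    dualNorm A v = weightedNorm A (A.inverse v) := by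
  rw [dualNorm, weightedNorm, hA.apply_inverse, real_inner_comm]

lemma dualNorm_apply (hA : IsPosDef A) (u : Vec p) : dualNorm A (A u) = weightedNorm A u := by
  rw [dualNorm, weightedNorm, hA.inner_comm, real_inner_comm, hA.inner_comm, hA.apply_inverse]

lemma abs_inner_le_of_diag (hA : IsPosDef A) {T : Op p}
    (hT : (T : Vec p →ₗ[ℝ] Vec p).IsSymmetric) {c : ℝ}
    (h : ∀ u, |inner ℝ (T u) u| ≤ c * weightedNorm A u ^ 2) (u v : Vec p) :
    |inner ℝ (T u) v| ≤ c * (weightedNorm A u * weightedNorm A v) := by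
  have hpolarization : ∀ u v : Vec p, |inner ℝ (T u) v| ≤
      c * (weightedNorm A u ^ 2 + weightedNorm A v ^ 2) / 2 := by
    intro u v
    have hadd := h (u + v)
    have hsub := h (u - v)
    have hTuv : inner ℝ (T u) v = inner ℝ (T v) u := (hT u v).trans (real_inner_comm _ _)
    have hAuv := hA.inner_comm u v
    simp only [hA.weightedNorm_sq, map_add, map_sub, inner_add_left, inner_add_right,
      inner_sub_left, inner_sub_right, abs_le] at hadd hsub ⊢
    constructor <;> linarith [hAuv]
  rcases (weightedNorm_nonneg A u).eq_or_lt with hu | hu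
  · simp [hA.eq_zero_of_weightedNorm_eq_zero hu.symm, weightedNorm]
  rcases (weightedNorm_nonneg A v).eq_or_lt with hv | hv
  · simp [hA.eq_zero_of_weightedNorm_eq_zero hv.symm, weightedNorm]
  -- Scale `u` and `v` to have equal weighted norms.
  have hscaled := hpolarization (weightedNorm A v • u) (weightedNorm A u • v)
  rw [weightedNorm_smul, weightedNorm_smul, map_smul, real_inner_smul_left,
    real_inner_smul_right, abs_mul, abs_mul, abs_of_pos hu, abs_of_pos hv] at hscaled
  refine le_of_mul_le_mul_left ?_ (mul_pos hu hv)
  linarith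

lemma inner_le (hA : IsPosDef A) (u v : Vec p) :
    inner ℝ (A u) v ≤ weightedNorm A u * weightedNorm A v := by
  have := hA.abs_inner_le_of_diag hA.1 (c := 1)
    (fun u => by rw [hA.weightedNorm_sq, one_mul, abs_of_nonneg (hA.inner_self_nonneg u)]) u v
  rw [one_mul] at this
  exact (le_abs_self _).trans this

lemma inner_le_dualNorm (hA : IsPosDef A) (v u : Vec p) :
    inner ℝ v u ≤ dualNorm A v * weightedNorm A u := by
  have := hA.inner_le (A.inverse v) u
  rwa [hA.apply_inverse, ← hA.dualNorm_eq] at this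

lemma dualNorm_le (hA : IsPosDef A) {v : Vec p} {c : ℝ} (hc : 0 ≤ c)
    (h : ∀ u, inner ℝ v u ≤ c * weightedNorm A u) : dualNorm A v ≤ c := by
  have hle : dualNorm A v ^ 2 ≤ c * dualNorm A v := by
    rw [hA.dualNorm_eq, hA.weightedNorm_sq, hA.apply_inverse]
    exact h _
  by_contra! hlt
  nlinarith

lemma dualNorm_le_div (hA : IsPosDef A) {v : Vec p} {c ρ : ℝ} (hρ : 0 < ρ)
    (h : ∀ u, weightedNorm A u ≤ ρ → inner ℝ v u ≤ c) : dualNorm A v ≤ c / ρ := by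
  have hc : 0 ≤ c := by simpa using h 0 (by simpa [weightedNorm] using hρ.le)
  refine hA.dualNorm_le (by positivity) fun u => ?_
  rcases (weightedNorm_nonneg A u).eq_or_lt with hu | hu
  · simp [hA.eq_zero_of_weightedNorm_eq_zero hu.symm, weightedNorm]
  have hscaled := h ((ρ / weightedNorm A u) • u) (by
    rw [weightedNorm_smul, abs_of_pos (div_pos hρ hu), div_mul_cancel₀ _ hu.ne'])
  rw [real_inner_smul_right, div_mul_eq_mul_div, div_le_iff₀ hu] at hscaled
  rw [div_mul_eq_mul_div, le_div_iff₀ hρ]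
  linarith

lemma weightedNorm_add_le (hA : IsPosDef A) (u v : Vec p) :
    weightedNorm A (u + v) ≤ weightedNorm A u + weightedNorm A v := by
  refine le_of_sq_le_sq ?_ (add_nonneg (weightedNorm_nonneg A u) (weightedNorm_nonneg A v))
  have hsq := hA.weightedNorm_sq (u + v)
  simp only [map_add, inner_add_left, inner_add_right, ← hA.weightedNorm_sq] at hsq
  linarith [hA.inner_le u v, hA.inner_comm u v]

lemma dualNorm_add_le (hA : IsPosDef A) (v w : Vec p) :
    dualNorm A (v + w) ≤ dualNorm A v + dualNorm A w :=
  hA.dualNorm_le (add_nonneg (dualNorm_nonneg A v) (dualNorm_nonneg A w)) fun u => by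
    rw [inner_add_left, add_mul]
    exact add_le_add (hA.inner_le_dualNorm v u) (hA.inner_le_dualNorm w u)

lemma dualNorm_sub_le (hA : IsPosDef A) (v w : Vec p) :
    dualNorm A (v - w) ≤ dualNorm A v + dualNorm A w := by
  simpa only [sub_eq_add_neg, dualNorm_neg] using hA.dualNorm_add_le v (-w)

lemma dualNorm_le_mul_dualNorm (hA : IsPosDef A) (hB : IsPosDef B) {κ : ℝ} (hκ : 0 ≤ κ)
    (h : ∀ u, weightedNorm A u ≤ κ * weightedNorm B u) (v : Vec p) :
    dualNorm B v ≤ κ * dualNorm A v :=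
  hB.dualNorm_le (mul_nonneg hκ (dualNorm_nonneg A v)) fun u => by
    calc inner ℝ v u ≤ dualNorm A v * weightedNorm A u := hA.inner_le_dualNorm v u
      _ ≤ dualNorm A v * (κ * weightedNorm B u) :=
        mul_le_mul_of_nonneg_left (h u) (dualNorm_nonneg A v)
      _ = κ * dualNorm A v * weightedNorm B u := by ring

/-- Completing the square: the bound is `0 ≤ ‖d - w - A⁻¹ b‖²`. -/
lemma weightedNorm_sq_le_of_inner_nonneg (hA : IsPosDef A) {b d w : Vec p}
    (h : 0 ≤ inner ℝ (b - A d) (d - w)) :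
    weightedNorm A d ^ 2 ≤ weightedNorm A w ^ 2 + dualNorm A b ^ 2 := by
  obtain ⟨q, rfl⟩ : ∃ q, A q = b := ⟨_, hA.apply_inverse b⟩
  rw [hA.dualNorm_apply]
  have hsq := hA.inner_self_nonneg (d - w - q)
  have hdw := hA.inner_comm d w
  have hdq := hA.inner_comm d q
  have hwq := hA.inner_comm w q
  simp only [hA.weightedNorm_sq, map_sub, inner_sub_left, inner_sub_right] at h hsq ⊢
  linarith

end IsPosDef

end WeightedNorms

open Set

section Subdifferential

variable {p : ℕ} {D : Set (Vec p)} {R : Vec p → ℝ}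

lemma subdifferential_mono {z z' s s' : Vec p} (hs : s ∈ subdifferential D R z)
    (hs' : s' ∈ subdifferential D R z') : 0 ≤ inner ℝ (s' - s) (z' - z) := by
  have h := hs.2 z' hs'.1
  have h' := hs'.2 z hs.1
  rw [← neg_sub z' z, inner_neg_right] at h'
  rw [inner_sub_left]
  linarith

end Subdifferential

/-- The relation `(1 - δ)² ∇²f(x) ⪯ A ⪯ (1 + δ)² ∇²f(x)` for a positive definite operator `A`,
stated for quadratic forms. -/
structure IsHessianApprox {p : ℕ} (f : Vec p → ℝ) (x : Vec p) (A : Op p) (δ : ℝ) : Prop where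
  posDef : IsPosDef A
  nonneg : 0 ≤ δ
  lt_one : δ < 1
  lower : ∀ u, (1 - δ) ^ 2 * hessForm f x u u ≤ weightedNorm A u ^ 2
  upper : ∀ u, weightedNorm A u ^ 2 ≤ (1 + δ) ^ 2 * hessForm f x u u

/-- A constant of equivalence between the norms defined by two operators that approximate, with
relative error `δ`, the Hessians at two points at local distance at most `r`. -/
noncomputable def distortion (δ r : ℝ) : ℝ := (1 + δ) / ((1 - δ) * (1 - r))

lemma distortion_nonneg {δ r : ℝ} (hδ : 0 ≤ δ) (hδ1 : δ < 1) (hr : r < 1) :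
    0 ≤ distortion δ r :=
  div_nonneg (by linarith) (mul_nonneg (by linarith) (by linarith))

lemma mul_one_sub_div_le_one {α δ r : ℝ} (hα : 0 ≤ α) (hδ : 0 ≤ δ) (hδ1 : δ < 1)
    (hr : 0 ≤ r) (hr1 : r < 1)
    (h : α / ((1 - r) ^ 2 * (1 - δ) ^ 2) + α * (1 - 2 * r) / (1 + δ) ^ 2 ≤ 2) :
    α * (1 - r) / (1 + δ) ^ 2 ≤ 1 := by
  rw [← sub_pos] at hδ1 hr1
  have hle : α / (1 + δ) ^ 2 ≤ α / ((1 - r) ^ 2 * (1 - δ) ^ 2) := by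
    gcongr
    calc (1 - r) ^ 2 * (1 - δ) ^ 2 ≤ 1 ^ 2 * (1 + δ) ^ 2 := by gcongr <;> linarith
      _ = (1 + δ) ^ 2 := by ring
  ring_nf at hle h ⊢
  linarith

namespace IsHessianApprox

variable {p : ℕ} {D : Set (Vec p)} {f : Vec p → ℝ} {x y : Vec p} {A B : Op p} {δ δ' r α : ℝ}

lemma of_loewner (hf : ContDiffAt ℝ 2 f x) (hA : IsPosDef A) (h0 : 0 ≤ δ) (h1 : δ < 1)
    (hl : (1 - δ) ^ 2 • hessian f x ≤ A) (hu : A ≤ (1 + δ) ^ 2 • hessian f x) :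
    IsHessianApprox f x A δ := by
  have hform (c : ℝ) (u : Vec p) :
      inner ℝ ((c • hessian f x) u) u = c * hessForm f x u u := by
    rw [smul_apply, real_inner_smul_left, inner_hessian hf]
  refine ⟨hA, h0, h1, fun u => ?_, fun u => ?_⟩
  · have h := ((ContinuousLinearMap.le_def _ _).1 hl).inner_nonneg_left u
    rw [sub_apply, inner_sub_left, hform, ← hA.weightedNorm_sq] at h
    exact sub_nonneg.1 h
  · have h := ((ContinuousLinearMap.le_def _ _).1 hu).inner_nonneg_left u
    rw [sub_apply, inner_sub_left, hform, ← hA.weightedNorm_sq] at h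
    exact sub_nonneg.1 h

lemma hessForm_nonneg (hA : IsHessianApprox f x A δ) (u : Vec p) : 0 ≤ hessForm f x u u := by
  have hδ := hA.nonneg
  exact nonneg_of_mul_nonneg_right ((sq_nonneg _).trans (hA.upper u)) (by positivity)

lemma mono (hA : IsHessianApprox f x A δ) (h : δ ≤ δ') (h1 : δ' < 1) :
    IsHessianApprox f x A δ' := by
  have hδ := hA.nonneg
  refine ⟨hA.posDef, hδ.trans h, h1, fun u => ?_, fun u => ?_⟩
  · refine (mul_le_mul_of_nonneg_right ?_ (hA.hessForm_nonneg u)).trans (hA.lower u)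
    exact pow_le_pow_left₀ (by linarith) (by linarith) 2
  · refine (hA.upper u).trans (mul_le_mul_of_nonneg_right ?_ (hA.hessForm_nonneg u))
    exact pow_le_pow_left₀ (by linarith) (by linarith) 2

lemma sqrt_hessForm_le (hA : IsHessianApprox f x A δ) (hr : 0 ≤ r) {h : Vec p}
    (hh : weightedNorm A h ≤ r * (1 - δ)) : √(hessForm f x h h) ≤ r := by
  have hδ : 0 < 1 - δ := sub_pos.2 hA.lt_one
  refine Real.sqrt_le_iff.2 ⟨hr, le_of_mul_le_mul_left ?_ (by positivity : 0 < (1 - δ) ^ 2)⟩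
  calc (1 - δ) ^ 2 * hessForm f x h h ≤ weightedNorm A h ^ 2 := hA.lower h
    _ ≤ (r * (1 - δ)) ^ 2 := pow_le_pow_left₀ (weightedNorm_nonneg A h) hh 2
    _ = (1 - δ) ^ 2 * r ^ 2 := by ring

lemma weightedNorm_le_distortion_mul (hA : IsHessianApprox f x A δ) (hB : IsHessianApprox f y B δ)
    (hr : r < 1) {u : Vec p} (h : (1 - r) ^ 2 * hessForm f x u u ≤ hessForm f y u u) :
    weightedNorm A u ≤ distortion δ r * weightedNorm B u := by
  have hδ := hA.nonneg
  have hδ1 : 0 < 1 - δ := sub_pos.2 hA.lt_one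
  have : 0 < 1 - r := sub_pos.2 hr
  rw [distortion, div_mul_eq_mul_div, le_div_iff₀ (by positivity)]
  refine le_of_sq_le_sq ?_ (mul_nonneg (by linarith) (weightedNorm_nonneg _ _))
  calc (weightedNorm A u * ((1 - δ) * (1 - r))) ^ 2
      = weightedNorm A u ^ 2 * ((1 - δ) ^ 2 * (1 - r) ^ 2) := by ring
    _ ≤ (1 + δ) ^ 2 * hessForm f x u u * ((1 - δ) ^ 2 * (1 - r) ^ 2) := by
      gcongr; exact hA.upper u
    _ = (1 + δ) ^ 2 * (1 - δ) ^ 2 * ((1 - r) ^ 2 * hessForm f x u u) := by ring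
    _ ≤ (1 + δ) ^ 2 * (1 - δ) ^ 2 * hessForm f y u u := by gcongr
    _ = (1 + δ) ^ 2 * ((1 - δ) ^ 2 * hessForm f y u u) := by ring
    _ ≤ (1 + δ) ^ 2 * weightedNorm B u ^ 2 := by gcongr; exact hB.lower u
    _ = ((1 + δ) * weightedNorm B u) ^ 2 := by ring

section Segment

variable {d : Vec p} (hA : IsHessianApprox f x A δ) (hsc : StandardSelfConcordant D f)
  (hseg : ∀ t ∈ Icc (0 : ℝ) 1, x + t • (α • d) ∈ D) (hα : 0 ≤ α)
  (hr : α * weightedNorm A d ≤ r * (1 - δ)) (hr0 : 0 ≤ r) (hr1 : r < 1)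

include hA hsc hseg hα hr hr0 hr1

lemma hessForm_segment_bounds {t : ℝ} (ht : t ∈ Icc (0 : ℝ) 1) (v : Vec p) :
    (1 - t * r) ^ 2 * hessForm f x v v ≤ hessForm f (x + t • (α • d)) v v ∧
      (1 - t * r) ^ 2 * hessForm f (x + t • (α • d)) v v ≤ hessForm f x v v := by
  refine hsc.hessForm_line_bounds hseg (hA.sqrt_hessForm_le hr0 ?_) hr1 ht v
  rwa [weightedNorm_smul, abs_of_nonneg hα]

lemma abs_inner_sub_hessian_diag_le {t : ℝ} (ht : t ∈ Icc (0 : ℝ) 1)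
    (hdom : α / ((1 - t * r) ^ 2 * (1 - δ) ^ 2) + α * (1 - 2 * (t * r)) / (1 + δ) ^ 2 ≤ 2)
    (v : Vec p) :
    |inner ℝ ((A - α • hessian f (x + t • (α • d))) v) v| ≤
      (1 - α * (1 - 2 * (t * r)) / (1 + δ) ^ 2) * weightedNorm A v ^ 2 := by
  have hδ := hA.nonneg
  have hδ1 : 0 < 1 - δ := sub_pos.2 hA.lt_one
  have htr : 0 < 1 - t * r := by linarith [mul_le_of_le_one_left hr0 ht.2]
  obtain ⟨hlow, hup⟩ := hA.hessForm_segment_bounds hsc hseg hα hr hr0 hr1 ht v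
  simp only [sub_apply, smul_apply, inner_sub_left, real_inner_smul_left,
    inner_hessian (hsc.contDiffAt_two (hseg t ht)), ← hA.posDef.weightedNorm_sq]
  set N := weightedNorm A v ^ 2 with hN
  set q := hessForm f (x + t • (α • d)) v v
  have hq_le : q ≤ N / ((1 - t * r) ^ 2 * (1 - δ) ^ 2) := by
    rw [le_div_iff₀ (by positivity)]
    calc q * ((1 - t * r) ^ 2 * (1 - δ) ^ 2) = (1 - δ) ^ 2 * ((1 - t * r) ^ 2 * q) := by ring
      _ ≤ (1 - δ) ^ 2 * hessForm f x v v := by gcongr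
      _ ≤ N := hA.lower v
  have hle_q : (1 - 2 * (t * r)) * N / (1 + δ) ^ 2 ≤ q := by
    rw [div_le_iff₀ (by positivity)]
    calc (1 - 2 * (t * r)) * N ≤ (1 - t * r) ^ 2 * N := by
          gcongr; linarith [sq_nonneg (t * r)]
      _ ≤ (1 - t * r) ^ 2 * ((1 + δ) ^ 2 * hessForm f x v v) := by gcongr; exact hA.upper v
      _ = (1 - t * r) ^ 2 * hessForm f x v v * (1 + δ) ^ 2 := by ring
      _ ≤ q * (1 + δ) ^ 2 := by gcongr
  have hup' := mul_le_mul_of_nonneg_left hq_le hα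
  have hlow' := mul_le_mul_of_nonneg_left hle_q hα
  have hdom' := mul_le_mul_of_nonneg_right hdom (hN ▸ sq_nonneg (weightedNorm A v) : 0 ≤ N)
  ring_nf at hup' hlow' hdom' ⊢
  exact abs_le.2 ⟨by linarith, by linarith⟩

variable (hdom : ∀ s ∈ Icc 0 r,
  α / ((1 - s) ^ 2 * (1 - δ) ^ 2) + α * (1 - 2 * s) / (1 + δ) ^ 2 ≤ 2)

include hdom

lemma inner_sub_hessForm_le {t : ℝ} (ht : t ∈ Icc (0 : ℝ) 1) (u : Vec p) :
    inner ℝ (A d) u - hessForm f (x + t • (α • d)) (α • d) u ≤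
      (1 - α * (1 - 2 * (t * r)) / (1 + δ) ^ 2) * (weightedNorm A d * weightedNorm A u) := by
  have hf := hsc.contDiffAt_two (hseg t ht)
  have hsymm : ((A - α • hessian f (x + t • (α • d)) : Op p) : Vec p →ₗ[ℝ] Vec p).IsSymmetric :=
    fun u v => by
      simp only [ContinuousLinearMap.coe_coe, sub_apply, smul_apply, inner_sub_left,
        real_inner_smul_left, inner_hessian hf, real_inner_comm _ u,
        hessForm_symm hf u v, hA.posDef.inner_comm u v]
  have h := hA.posDef.abs_inner_le_of_diag hsymm
    (hA.abs_inner_sub_hessian_diag_le hsc hseg hα hr hr0 hr1 ht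
      (hdom _ ⟨mul_nonneg ht.1 hr0, mul_le_of_le_one_left hr0 ht.2⟩)) d u
  rw [sub_apply, inner_sub_left, smul_apply, ← map_smul, inner_hessian hf] at h
  exact (le_abs_self _).trans h

lemma dualNorm_sub_gradient_le :
    dualNorm A (A d - (gradient f (x + α • d) - gradient f x)) ≤
      (1 - α * (1 - r) / (1 + δ) ^ 2) * weightedNorm A d := by
  have hc : 0 ≤ 1 - α * (1 - r) / (1 + δ) ^ 2 := sub_nonneg.2 <|
    mul_one_sub_div_le_one hα hA.nonneg hA.lt_one hr0 hr1 (hdom r ⟨hr0, le_rfl⟩)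
  refine hA.posDef.dualNorm_le (mul_nonneg hc (weightedNorm_nonneg A d)) fun u => ?_
  set N := weightedNorm A d * weightedNorm A u
  have hmono : MonotoneOn (fun t : ℝ => N * (t - α * (t - t ^ 2 * r) / (1 + δ) ^ 2)
      - (t * inner ℝ (A d) u - fderiv ℝ f (x + t • (α • d)) u)) (Icc 0 1) := by
    refine monotoneOn_Icc_of_hasDerivAt
      (φ' := fun t => N * (1 - α * (1 - 2 * (t * r)) / (1 + δ) ^ 2)
        - (inner ℝ (A d) u - hessForm f (x + t • (α • d)) (α • d) u))
      (fun t ht => ?_) fun t ht => ?_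
    · have hquad : HasDerivAt (fun t : ℝ => N * (t - α * (t - t ^ 2 * r) / (1 + δ) ^ 2))
          (N * (1 - α * (1 - 2 * (t * r)) / (1 + δ) ^ 2)) t := by
        have := ((hasDerivAt_id t).sub ((((hasDerivAt_id t).sub
          (((hasDerivAt_id t).pow 2).mul_const r)).const_mul α).div_const
            ((1 + δ) ^ 2))).const_mul N
        simpa [mul_assoc] using this
      have hlin := ((hasDerivAt_id t).mul_const (inner ℝ (A d) u)).sub
        (hasDerivAt_fderiv_line (hsc.contDiffAt_two (hseg t ht)) u)
      rw [one_mul] at hlin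
      exact hquad.sub hlin
    · rw [mul_comm N]
      exact sub_nonneg.2 (hA.inner_sub_hessForm_le hsc hseg hα hr hr0 hr1 hdom ht u)
  have h := hmono (left_mem_Icc.2 zero_le_one) (right_mem_Icc.2 zero_le_one) zero_le_one
  simp only [zero_smul, add_zero, one_smul, N] at h
  rw [inner_sub_left, inner_sub_left, inner_gradient_left, inner_gradient_left]
  ring_nf at h ⊢
  linarith

end Segment

end IsHessianApprox

/-- `z` is an inexact proximal Newton point at `x`: the gradient of `f` at `x` and the subproblem
with the approximate Hessian `A` have relative accuracy `δ` and absolute accuracy `δ₂`. The error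
of the gradient and the residual of the subproblem enter through their difference `e` only. -/
structure IsInexactProxNewtonPoint {p : ℕ} (f : Vec p → ℝ) (DR : Set (Vec p)) (R : Vec p → ℝ)
    (δ δ₂ : ℝ) (x : Vec p) (A : Op p) (z : Vec p) : Prop where
  hessianApprox : IsHessianApprox f x A δ
  optimality : ∃ e : Vec p, e - (gradient f x + A (z - x)) ∈ subdifferential DR R z ∧
    dualNorm A e ≤ δ * weightedNorm A (z - x) + δ₂

lemma IsInexactProxNewtonPoint.weightedNorm_sq_le {p : ℕ} {D : Set (Vec p)} {f : Vec p → ℝ}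
    {DR : Set (Vec p)} {R : Vec p → ℝ} {δ δ₂ α r : ℝ} {x x' z z' : Vec p} {A A' : Op p}
    (hz : IsInexactProxNewtonPoint f DR R δ δ₂ x A z)
    (hz' : IsInexactProxNewtonPoint f DR R δ δ₂ x' A' z') (hsc : StandardSelfConcordant D f)
    (hx' : x' = x + α • (z - x)) (hα : 0 ≤ α) (hα1 : α ≤ 1)
    (hseg : ∀ t ∈ Icc (0 : ℝ) 1, x + t • (α • (z - x)) ∈ D)
    (hr : α * weightedNorm A (z - x) ≤ r * (1 - δ)) (hr0 : 0 ≤ r) (hr1 : r < 1)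
    (hdom : ∀ s ∈ Icc 0 r,
      α / ((1 - s) ^ 2 * (1 - δ) ^ 2) + α * (1 - 2 * s) / (1 + δ) ^ 2 ≤ 2) :
    weightedNorm A' (z' - x') ^ 2 ≤
      ((1 - α) * distortion δ r * weightedNorm A (z - x)) ^ 2 +
        (δ * weightedNorm A' (z' - x') + δ₂ * (1 + distortion δ r) + distortion δ r *
          (δ + (1 - α * (1 - r) / (1 + δ) ^ 2)) * weightedNorm A (z - x)) ^ 2 := by
  obtain ⟨hA, e, hs, he⟩ := hz
  obtain ⟨hA', e', hs', he'⟩ := hz'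
  have hgrad := hA.dualNorm_sub_gradient_le hsc hseg hα hr hr0 hr1 hdom
  have hκ := distortion_nonneg hA.nonneg hA.lt_one hr1
  have hbounds := hA.hessForm_segment_bounds hsc hseg hα hr hr0 hr1 (t := 1) (by simp)
  simp only [one_smul, ← hx', one_mul] at hgrad hbounds
  generalize hd : z - x = d at *
  generalize hd' : z' - x' = d' at *
  have hnorm (u) : weightedNorm A u ≤ distortion δ r * weightedNorm A' u :=
    hA.weightedNorm_le_distortion_mul hA' hr1 (hbounds u).1
  have hnorm' (u) : weightedNorm A' u ≤ distortion δ r * weightedNorm A u :=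
    hA'.weightedNorm_le_distortion_mul hA hr1 (hbounds u).2
  have hdual (v) : dualNorm A' v ≤ distortion δ r * dualNorm A v :=
    hA.posDef.dualNorm_le_mul_dualNorm hA'.posDef hκ hnorm v
  have hb : dualNorm A' (e' - e + (A d - (gradient f x' - gradient f x))) ≤
      δ * weightedNorm A' d' + δ₂ * (1 + distortion δ r) + distortion δ r *
        (δ + (1 - α * (1 - r) / (1 + δ) ^ 2)) * weightedNorm A d := by
    have h₁ := hA'.posDef.dualNorm_add_le (e' - e) (A d - (gradient f x' - gradient f x))
    have h₂ := hA'.posDef.dualNorm_sub_le e' e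
    have h₃ := (hdual e).trans (mul_le_mul_of_nonneg_left he hκ)
    have h₄ := (hdual _).trans (mul_le_mul_of_nonneg_left hgrad hκ)
    linarith
  have hw : weightedNorm A' ((1 - α) • d) ≤ (1 - α) * distortion δ r * weightedNorm A d := by
    rw [weightedNorm_smul, abs_of_nonneg (by linarith), mul_assoc]
    exact mul_le_mul_of_nonneg_left (hnorm' d) (by linarith)
  have hmono : 0 ≤ inner ℝ (e' - e + (A d - (gradient f x' - gradient f x)) - A' d')
      (d' - (1 - α) • d) := by
    convert subdifferential_mono hs hs' using 2
    · abel
    · rw [← sub_add_cancel z' x', ← sub_add_cancel z x, hd, hd', hx']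
      module
  exact (hA'.posDef.weightedNorm_sq_le_of_inner_nonneg hmono).trans
    (add_le_add (pow_le_pow_left₀ (weightedNorm_nonneg _ _) hw 2)
      (pow_le_pow_left₀ (dualNorm_nonneg _ _) hb 2))

section DampedStep

variable {δ δ₄ lam a s : ℝ}

lemma exists_inv_eq_dampedStep (hδ : δ < 1) (h4 : 0 ≤ δ₄) (h4' : δ₄ ≤ δ) :
    ∃ a, dampedStep δ δ₄ lam = a⁻¹ ∧ (1 + δ) ^ 2 + (1 + δ) * lam ≤ a ∧
      (a - (1 + δ) * lam) * (1 - δ) ≤ (1 + δ) ^ 2 := by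
  have h : 0 < 1 - δ₄ := by linarith
  refine ⟨(1 + δ) ^ 2 / (1 - δ₄) + (1 + δ) * lam, ?_, ?_, ?_⟩
  · rw [dampedStep, ← inv_div]
    congr 1
    field_simp
  · gcongr
    rw [le_div_iff₀ h]
    exact mul_le_of_le_one_right (sq_nonneg _) (by linarith)
  · rw [add_sub_cancel_right, div_mul_eq_mul_div, div_le_iff₀ h]
    gcongr

lemma distortion_inv (hδ : δ < 1) (ha : 0 < a) :
    distortion δ (a⁻¹ * lam / (1 - δ)) = (1 + δ) * a / (a * (1 - δ) - lam) := by
  have hδ' : 1 - δ ≠ 0 := (sub_pos.2 hδ).ne'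
  have hden : (1 - δ) * (1 - a⁻¹ * lam / (1 - δ)) = (a * (1 - δ) - lam) / a := by
    field_simp
  rw [distortion, hden, div_div_eq_mul_div]

lemma inv_mul_div_le (hδ : 0 ≤ δ) (hδ1 : δ ≤ 1 / 100) (hl : 0 ≤ lam) (ha : 1 + 2 * δ + lam ≤ a) :
    a⁻¹ * lam / (1 - δ) ≤ lam := by
  rw [div_le_iff₀ (by linarith), mul_comm]
  refine mul_le_mul_of_nonneg_left (inv_le_of_inv_le₀ (by linarith) ?_) hl
  rw [inv_le_iff_one_le_mul₀ (by linarith)]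
  nlinarith

lemma inv_one_sub_sq_le (h0 : 0 ≤ s) (h1 : s ≤ 1 / 20) :
    ((1 - s) ^ 2)⁻¹ ≤ 1 + 2 * s + 4 * s ^ 2 := by
  rw [inv_le_iff_one_le_mul₀ (by nlinarith)]
  have : 0 ≤ s ^ 2 * (1 - 6 * s + 4 * s ^ 2) := mul_nonneg (sq_nonneg s) (by nlinarith)
  linarith

lemma damping_dominates (hδ : 0 ≤ δ) (hδ1 : δ ≤ 1 / 100) (hs : 0 ≤ s) (hsl : s ≤ lam)
    (hl : lam ≤ 1 / 20) (ha : 1 + 2 * δ + lam ≤ a) :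
    a⁻¹ / ((1 - s) ^ 2 * (1 - δ) ^ 2) + a⁻¹ * (1 - 2 * s) / (1 + δ) ^ 2 ≤ 2 := by
  have ha0 : 0 < a := by linarith
  have hinv : ((1 - s) ^ 2)⁻¹ * ((1 - δ) ^ 2)⁻¹ ≤
      (1 + 2 * s + 4 * s ^ 2) * (1 + 2 * δ + 4 * δ ^ 2) :=
    mul_le_mul (inv_one_sub_sq_le hs (hsl.trans hl)) (inv_one_sub_sq_le hδ (by linarith))
      (by positivity) (by positivity)
  have hinv' : (1 - 2 * s) * ((1 + δ) ^ 2)⁻¹ ≤ 1 - 2 * s :=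
    mul_le_of_le_one_right (by linarith) (inv_le_one_of_one_le₀ (by nlinarith))
  have hδ_le : 2 * δ + 4 * δ ^ 2 ≤ 3 * δ := by nlinarith
  have hs_le : 2 * s + 4 * s ^ 2 ≤ 1 / 5 := by nlinarith
  have hs_sq : 4 * s ^ 2 ≤ lam := by nlinarith
  have hprod := mul_le_mul_of_nonneg_right hs_le (by positivity : 0 ≤ 2 * δ + 4 * δ ^ 2)
  calc a⁻¹ / ((1 - s) ^ 2 * (1 - δ) ^ 2) + a⁻¹ * (1 - 2 * s) / (1 + δ) ^ 2
      = a⁻¹ * (((1 - s) ^ 2)⁻¹ * ((1 - δ) ^ 2)⁻¹ + (1 - 2 * s) * ((1 + δ) ^ 2)⁻¹) := by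
        rw [← mul_inv]; ring
    _ ≤ a⁻¹ * (2 * a) := by gcongr; linarith
    _ = 2 := by field_simp

lemma one_add_le_damping (hδ : 0 ≤ δ) (hl : 0 ≤ lam) (ha : (1 + δ) ^ 2 + (1 + δ) * lam ≤ a) :
    1 + 2 * δ + lam ≤ a := by
  linarith [sq_nonneg δ, mul_nonneg hδ hl]

variable (hδ : 0 ≤ δ) (hδ1 : δ ≤ 1 / 100) (hl : 0 ≤ lam) (hl1 : lam ≤ 1 / 20)
  (ha : (1 + δ) ^ 2 + (1 + δ) * lam ≤ a)

include hδ hδ1 hl hl1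

include ha

lemma mul_one_sub_sub_pos : 0 < a * (1 - δ) - lam := by
  nlinarith [one_add_le_damping hδ hl ha, mul_nonneg hδ hl]

lemma distortion_le : distortion δ (a⁻¹ * lam / (1 - δ)) ≤ 1 + lam + 21 / 10 * δ := by
  have ha1 := one_add_le_damping hδ hl ha
  rw [distortion_inv (by linarith) (by linarith),
    div_le_iff₀ (mul_one_sub_sub_pos hδ hδ1 hl hl1 ha)]
  have hcoef : 0 ≤ lam * (1 - δ) + δ * (1 / 10 - 21 / 10 * δ) :=
    add_nonneg (mul_nonneg hl (by linarith)) (mul_nonneg hδ (by linarith))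
  have hrest : 0 ≤ 1 / 10 - lam - 19 / 10 * δ - lam * lam - 41 / 10 * (δ * lam)
      - 42 / 10 * (δ * δ) := by
    have hll : lam * lam ≤ 1 / 20 * (1 / 20) := by gcongr
    have hdl : δ * lam ≤ 1 / 100 * (1 / 20) := by gcongr
    have hdd : δ * δ ≤ 1 / 100 * (1 / 100) := by gcongr
    linarith
  linarith [mul_le_mul_of_nonneg_right ha1 hcoef, mul_nonneg hδ hrest]

variable (ha' : (a - (1 + δ) * lam) * (1 - δ) ≤ (1 + δ) ^ 2)

include ha'

lemma one_sub_mul_distortion_le :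
    (1 - a⁻¹) * distortion δ (a⁻¹ * lam / (1 - δ)) ≤ lam + 32 / 10 * δ := by
  have ha1 := one_add_le_damping hδ hl ha
  have ha0 : 0 < a := by linarith
  have hδ' : 0 < 1 - δ := by linarith
  have heq : (1 - a⁻¹) * distortion δ (a⁻¹ * lam / (1 - δ)) =
      (a - 1) * (1 + δ) / (a * (1 - δ) - lam) := by
    rw [distortion_inv (by linarith) ha0]
    field_simp
  rw [heq, div_le_iff₀ (mul_one_sub_sub_pos hδ hδ1 hl hl1 ha)]
  refine le_of_mul_le_mul_right ?_ hδ'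
  have hcoef : 0 ≤ 1 + δ - (lam + 32 / 10 * δ) * (1 - δ) := by nlinarith
  have hrest : 0 ≤ 2 / 10 - 8 / 10 * δ - 42 / 10 * δ ^ 2 - 32 / 10 * δ ^ 3
      - lam * δ * (1 - δ) * (lam + 32 / 10 * δ) := by
    have h2 : δ ^ 2 ≤ (1 / 100) ^ 2 := by gcongr
    have h3 : δ ^ 3 ≤ (1 / 100) ^ 3 := by gcongr
    have h4 : lam * δ * (1 - δ) * (lam + 32 / 10 * δ) ≤
        1 / 20 * (1 / 100) * 1 * (1 / 20 + 32 / 10 * (1 / 100)) := by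
      gcongr; linarith
    linarith
  linarith [mul_le_mul_of_nonneg_left ha' hcoef, mul_nonneg hδ hrest]

lemma le_inv_damping : 1 - lam - 31 / 10 * δ + 9 / 10 * lam ^ 2 ≤ a⁻¹ := by
  have ha1 := one_add_le_damping hδ hl ha
  have hδlam := mul_le_mul_of_nonneg_left hl1 hδ
  have ha3 : a ≤ 1 + lam + 31 / 10 * δ := by nlinarith
  rw [← one_div, le_div_iff₀ (by linarith)]
  have hmul : 9 / 10 * lam * a ≤ a - 1 := by nlinarith
  have hmul' := mul_le_mul_of_nonneg_left hmul hl
  nlinarith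

lemma distortion_mul_error_le :
    distortion δ (a⁻¹ * lam / (1 - δ)) *
      (δ + (1 - a⁻¹ * (1 - a⁻¹ * lam / (1 - δ)) / (1 + δ) ^ 2)) ≤
        2 * lam + 63 / 10 * δ - 9 / 10 * lam ^ 2 := by
  have ha1 := one_add_le_damping hδ hl ha
  have ha0 : 0 < a := by linarith
  have hδ' : 0 < 1 - δ := by linarith
  have hr1 : 0 < 1 - a⁻¹ * lam / (1 - δ) := by
    linarith [inv_mul_div_le hδ hδ1 hl ha1]
  have hκ := distortion_le hδ hδ1 hl hl1 ha
  have heq : distortion δ (a⁻¹ * lam / (1 - δ)) *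
      (δ + (1 - a⁻¹ * (1 - a⁻¹ * lam / (1 - δ)) / (1 + δ) ^ 2)) =
        distortion δ (a⁻¹ * lam / (1 - δ)) * (1 + δ) - a⁻¹ / ((1 - δ) * (1 + δ)) := by
    generalize a⁻¹ * lam / (1 - δ) = r at hr1
    rw [distortion]
    field_simp
    ring
  have hα : a⁻¹ ≤ a⁻¹ / ((1 - δ) * (1 + δ)) := by
    rw [le_div_iff₀ (by positivity)]
    exact mul_le_of_le_one_right (by positivity) (by nlinarith)
  have hκδ : distortion δ (a⁻¹ * lam / (1 - δ)) * (1 + δ) ≤ 1 + lam + 3171 / 1000 * δ := by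
    have := mul_le_mul_of_nonneg_right hκ (by linarith : 0 ≤ 1 + δ)
    nlinarith [mul_le_mul_of_nonneg_left hl1 hδ]
  rw [heq]
  linarith [le_inv_damping hδ hδ1 hl hl1 ha ha']

end DampedStep

lemma segment_subset_of_ball_subset {p : ℕ} {D : Set (Vec p)} {A : Op p} {x d : Vec p} {ρ α : ℝ}
    (hball : ∀ y, weightedNorm A (y - x) < ρ → y ∈ D) (hα : 0 ≤ α) (hα1 : α ≤ 1)
    (hd : weightedNorm A d < ρ) {t : ℝ} (ht : t ∈ Icc (0 : ℝ) 1) :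
    x + t • (α • d) ∈ D := by
  refine hball _ (lt_of_le_of_lt ?_ hd)
  rw [add_sub_cancel_left, smul_smul, weightedNorm_smul, abs_of_nonneg (mul_nonneg ht.1 hα)]
  exact mul_le_of_le_one_left (weightedNorm_nonneg A d) (mul_le_one₀ ht.2 hα hα1)

namespace IsInexactProxNewtonPoint

variable {p : ℕ} {D : Set (Vec p)} {f : Vec p → ℝ} {DR : Set (Vec p)} {R : Vec p → ℝ}
  {δ δ₂ δ₄ : ℝ} {x x' z z' : Vec p} {A A' : Op p}

lemma weightedNorm_sq_le_of_dampedStep (hz : IsInexactProxNewtonPoint f DR R δ δ₂ x A z)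
    (hz' : IsInexactProxNewtonPoint f DR R δ δ₂ x' A' z') (hsc : StandardSelfConcordant D f)
    (hball : ∀ y, weightedNorm A (y - x) < 1 / (1 + δ) → y ∈ D)
    (h4 : 0 ≤ δ₄) (h4' : δ₄ ≤ δ) (hδ : δ ≤ 1 / 100)
    (hx' : x' = x + dampedStep δ δ₄ (weightedNorm A (z - x)) • (z - x)) {lam lam' : ℝ}
    (hlam : weightedNorm A (z - x) = lam) (hlam' : weightedNorm A' (z' - x') = lam')
    (h2 : 0 ≤ δ₂) (hl : lam ≤ 1 / 20) :
    lam' ^ 2 ≤ (lam * (lam + 32 / 10 * δ)) ^ 2 + (δ * lam' + δ₂ * (2 + lam + 21 / 10 * δ) +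
      lam * (2 * lam + 63 / 10 * δ - 9 / 10 * lam ^ 2)) ^ 2 := by
  have hδ0 := hz.hessianApprox.nonneg
  have hl0 : 0 ≤ lam := hlam ▸ weightedNorm_nonneg _ _
  have hl0' : 0 ≤ lam' := hlam' ▸ weightedNorm_nonneg _ _
  obtain ⟨a, hstep, ha, ha'⟩ :=
    exists_inv_eq_dampedStep (lam := lam) hz.hessianApprox.lt_one h4 h4'
  have ha1 := one_add_le_damping hδ0 hl0 ha
  have hr := inv_mul_div_le hδ0 hδ hl0 ha1
  have hκ := distortion_le hδ0 hδ hl0 hl ha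
  have hfirst := one_sub_mul_distortion_le hδ0 hδ hl0 hl ha ha'
  have hsecond := distortion_mul_error_le hδ0 hδ hl0 hl ha ha'
  have hα0 : 0 ≤ a⁻¹ := inv_nonneg.2 (by linarith)
  have hα1 : a⁻¹ ≤ 1 := inv_le_one_of_one_le₀ (by linarith)
  have hr0 : 0 ≤ a⁻¹ * lam / (1 - δ) := div_nonneg (mul_nonneg hα0 hl0) (by linarith)
  have hr1 : a⁻¹ * lam / (1 - δ) < 1 := by linarith
  have hr_eq : a⁻¹ * lam = a⁻¹ * lam / (1 - δ) * (1 - δ) := by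
    rw [div_mul_cancel₀]; linarith
  rw [hlam, hstep] at hx'
  have hseg (t : ℝ) := segment_subset_of_ball_subset (t := t) hball hα0 hα1
    (hlam.trans_lt (by rw [lt_div_iff₀ (by linarith)]; nlinarith))
  have hdom (s : ℝ) (hs : s ∈ Icc 0 (a⁻¹ * lam / (1 - δ))) :=
    damping_dominates hδ0 hδ hs.1 (hs.2.trans hr) hl ha1
  have hκ0 := distortion_nonneg hδ0 hz.hessianApprox.lt_one hr1
  have hc := mul_one_sub_div_le_one hα0 hδ0 (by linarith) hr0 hr1 (hdom _ ⟨hr0, le_rfl⟩)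
  have h := hz.weightedNorm_sq_le hz' hsc hx' hα0 hα1 hseg (hlam ▸ hr_eq.le) hr0 hr1 hdom
  rw [hlam, hlam'] at h
  refine h.trans (add_le_add (pow_le_pow_left₀ ?_ ?_ 2) (pow_le_pow_left₀ ?_ ?_ 2))
  · exact mul_nonneg (mul_nonneg (sub_nonneg.2 hα1) hκ0) hl0
  · rw [mul_comm lam]
    exact mul_le_mul_of_nonneg_right hfirst hl0
  · have := mul_nonneg (mul_nonneg hκ0 (add_nonneg hδ0 (sub_nonneg.2 hc))) hl0
    positivity
  · linarith [mul_le_mul_of_nonneg_left hκ h2, mul_le_mul_of_nonneg_right hsecond hl0]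

end IsInexactProxNewtonPoint

/-- A sequence of Newton decrements, each controlled by the previous one as in a step of the
damped method with relative errors at most `δ` and gradient errors at most `δ₂`. -/
structure DecrementRecursion (l : ℕ → ℝ) (δ δ₂ : ℝ) : Prop where
  nonneg : ∀ k, 0 ≤ l k
  delta_nonneg : 0 ≤ δ
  delta_le : δ ≤ 1 / 100
  delta2_nonneg : 0 ≤ δ₂
  succ_sq_le : ∀ k, l k ≤ 1 / 20 → l (k + 1) ^ 2 ≤ (l k * (l k + 32 / 10 * δ)) ^ 2 +
    (δ * l (k + 1) + δ₂ * (2 + l k + 21 / 10 * δ) +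
      l k * (2 * l k + 63 / 10 * δ - 9 / 10 * l k ^ 2)) ^ 2

namespace DecrementRecursion

variable {l : ℕ → ℝ} {δ δ₂ : ℝ}

lemma delta2_mul_le (h : DecrementRecursion l δ δ₂) {k : ℕ} (hk : l k ≤ 1 / 20) :
    δ₂ * (2 + l k + 21 / 10 * δ) ≤ 2071 / 1000 * δ₂ := by
  have := h.delta_le
  rw [mul_comm]
  exact mul_le_mul_of_nonneg_right (by linarith) h.delta2_nonneg

lemma succ_le (h : DecrementRecursion l δ δ₂) {k : ℕ} (hk : l k ≤ 1 / 20) :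
    l (k + 1) ≤ 224 / 100 * l k ^ 2 + 8 * δ * l k + 21 / 10 * δ₂ := by
  have hδ := h.delta_nonneg
  have hδ' := h.delta_le
  have hδ₂ := h.delta2_nonneg
  have hmain := h.succ_sq_le k hk
  have hδ₂' := h.delta2_mul_le hk
  have hY := h.nonneg (k + 1)
  have hx := h.nonneg k
  set x := l k
  set Y := l (k + 1)
  have hδx : 0 ≤ δ * x := by positivity
  set a := x * (x + 32 / 10 * δ) with ha
  set b := x * (2 * x + 63 / 10 * δ) with hb
  set W := 2237 / 1000 * x ^ 2 + 71 / 10 * δ * x with hW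
  set m := δ * Y + 2071 / 1000 * δ₂ with hm
  have hbW : b ≤ W := by rw [hb, hW]; nlinarith [sq_nonneg x]
  have habW : a ^ 2 + b ^ 2 ≤ W ^ 2 := by
    rw [ha, hb, hW]
    linarith [sq_nonneg (x ^ 2), sq_nonneg (δ * x), mul_nonneg hδx (sq_nonneg x)]
  have hYW : Y ≤ m + W := by
    refine (sq_le_sq₀ hY (by positivity)).1 (hmain.trans ?_)
    have hlast : 0 ≤ x * (2 * x + 63 / 10 * δ - 9 / 10 * x ^ 2) :=
      mul_nonneg hx (by nlinarith)
    have : (δ * Y + δ₂ * (2 + x + 21 / 10 * δ) +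
        x * (2 * x + 63 / 10 * δ - 9 / 10 * x ^ 2)) ^ 2 ≤ (m + b) ^ 2 := by
      refine pow_le_pow_left₀ (by positivity) (add_le_add (by linarith) ?_) 2
      exact mul_le_mul_of_nonneg_left (by linarith [sq_nonneg x]) hx
    have : m * b ≤ m * W := by gcongr
    linarith
  refine le_of_mul_le_mul_right ?_ (by linarith : 0 < 1 - δ)
  have e1 : δ * δ₂ ≤ 1 / 100 * δ₂ := by gcongr
  have e2 : δ * x ^ 2 ≤ 1 / 20 * (δ * x) := by nlinarith
  have e3 : δ * (δ * x) ≤ 1 / 100 * (δ * x) := by gcongr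
  linarith [sq_nonneg x]

lemma succ_le_of_le (h : DecrementRecursion l δ δ₂) {k : ℕ} {b : ℝ} (hb : l k ≤ b)
    (hb' : b ≤ 1 / 20) : l (k + 1) ≤ 224 / 100 * b ^ 2 + 8 * δ * b + 21 / 10 * δ₂ := by
  have h0 := h.nonneg k
  have h1 := h.delta_nonneg
  exact (h.succ_le (hb.trans hb')).trans (by gcongr)

/-- For decrements of the order of `1 / 20`, this keeps the lower order terms that
`DecrementRecursion.succ_le` gives away. -/
lemma succ_sq_le_of_le (h : DecrementRecursion l δ δ₂) {k : ℕ} (hk : l k ≤ 1 / 20) :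
    l (k + 1) ^ 2 ≤ (41 / 10000) ^ 2 +
      (1 / 100 * l (k + 1) + 2071 / 1000 * δ₂ + 81 / 10000) ^ 2 := by
  have hδ := h.delta_nonneg
  have hδ' := h.delta_le
  have hδ₂ := h.delta2_nonneg
  have hY := h.nonneg (k + 1)
  have hx := h.nonneg k
  have : 2 * l k + 63 / 10 * δ - 9 / 10 * l k ^ 2 ≤ 162 / 1000 := by nlinarith
  have hlast0 : 0 ≤ 2 * l k + 63 / 10 * δ - 9 / 10 * l k ^ 2 := by nlinarith
  refine (h.succ_sq_le k hk).trans (add_le_add ?_ ?_)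
  · exact pow_le_pow_left₀ (by positivity) (by nlinarith) 2
  · refine pow_le_pow_left₀ (by positivity) (add_le_add (add_le_add ?_ (h.delta2_mul_le hk)) ?_) 2
    · gcongr
    · nlinarith

/-- The constants in `DecrementRecursion.succ_sq_le_of_le` and in the bound on `δ₂` leave almost
no room at `ε = 1 / 20`. -/
lemma succ_le_of_delta2_le (h : DecrementRecursion l δ δ₂) {k : ℕ} (hk : l k ≤ 1 / 20) {ε : ℝ}
    (hε : 0.034 ≤ ε) (hε' : ε ≤ 1 / 20)
    (hδ₂ : δ₂ ≤ 37 / 20 * (0.1073 * (ε * (1 + 20 * ε)))) : l (k + 1) ≤ ε := by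
  by_contra! hY
  have hmain := h.succ_sq_le_of_le hk
  have h0 := h.delta2_nonneg
  set Y := l (k + 1)
  set M := 2071 / 1000 * (37 / 20 * (0.1073 * (ε * (1 + 20 * ε)))) + 81 / 10000 with hM
  have hM' : Y ^ 2 ≤ (41 / 10000) ^ 2 + (1 / 100 * Y + M) ^ 2 := by
    refine hmain.trans (add_le_add le_rfl (pow_le_pow_left₀ ?_ (by linarith) 2))
    have : 0 ≤ Y := by linarith
    positivity
  have hsub : 0.00525 - 0.1 * ε ≤ 99 / 100 * Y - M := by
    rw [hM]; nlinarith
  have hadd : 2.225 * ε - 0.0127 ≤ 101 / 100 * Y + M := by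
    rw [hM]; nlinarith
  have : (0.00525 - 0.1 * ε) * (2.225 * ε - 0.0127) ≤ (99 / 100 * Y - M) * (101 / 100 * Y + M) :=
    mul_le_mul hsub hadd (by linarith) (by linarith)
  nlinarith

lemma le_one_div_twenty (h : DecrementRecursion l δ δ₂) (h0 : l 0 ≤ 1 / 20)
    (hδ₂ : δ₂ ≤ 37 / 20 * 0.01073) (k : ℕ) : l k ≤ 1 / 20 := by
  induction k with
  | zero => exact h0
  | succ k ih => exact h.succ_le_of_delta2_le ih (by norm_num) le_rfl (by linarith)

lemma linear_rate (h : DecrementRecursion l δ δ₂) (h0 : l 0 ≤ 1 / 20) {ε : ℝ} (hε : 0 < ε)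
    (hε' : ε < 1 / 20) (hδ₂ : δ₂ ≤ 5 * ε / 32) : l ⌊Real.log (1 / ε)⌋₊ ≤ ε := by
  have hb := h.le_one_div_twenty h0 (by linarith)
  have hgeom : ∀ k, l k ≤ ε / 2 + (1 / 3) ^ k / 20 := by
    intro k
    induction k with
    | zero => linarith
    | succ k ih =>
      have hstep := h.succ_le (hb k)
      have h2 := h.nonneg k
      have h3 : 8 * δ * l k ≤ 8 * (1 / 100) * l k := by gcongr; exact h.delta_le
      have h4 : l k ^ 2 ≤ 1 / 20 * l k := by rw [sq]; gcongr; exact hb k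
      have : (0 : ℝ) < (1 / 3) ^ k := by positivity
      rw [pow_succ]
      linarith
  set k := ⌊Real.log (1 / ε)⌋₊
  have hk : -Real.log ε < k + 1 := by
    rw [← Real.log_inv, ← one_div]; exact Nat.lt_floor_add_one _
  have hpow : (1 / 3 : ℝ) ^ k ≤ 3 * ε :=
    calc (1 / 3 : ℝ) ^ k ≤ Real.exp (-1) ^ k :=
          pow_le_pow_left₀ (by norm_num) ((by norm_num : (1 / 3 : ℝ) ≤ 0.36787944116).trans
            Real.exp_neg_one_gt_d9.le) k
      _ = Real.exp (k * -1) := (Real.exp_nat_mul _ _).symm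
      _ ≤ Real.exp (1 + Real.log ε) := Real.exp_le_exp.2 (by linarith)
      _ = Real.exp 1 * ε := by rw [Real.exp_add, Real.exp_log hε]
      _ ≤ 3 * ε := by
        gcongr
        exact Real.exp_one_lt_d9.le.trans (by norm_num)
  linarith [hgeom k]

end DecrementRecursion

section ExpBounds

lemma exp_neg_pow {q : ℝ} {m n : ℕ} (hq : n * q = m) :
    Real.exp (-q) ^ n = Real.exp (-1) ^ m := by
  rw [← Real.exp_nat_mul, ← Real.exp_nat_mul, mul_neg, hq, mul_neg_one]

lemma le_exp_neg {c q : ℝ} {m n : ℕ} (hc : 0 ≤ c) (hn : n ≠ 0) (hq : n * q = m)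
    (h : c ^ n ≤ (0.36787944116 : ℝ) ^ m) : c ≤ Real.exp (-q) := by
  refine (pow_le_pow_iff_left₀ hc (Real.exp_pos _).le hn).1 (h.trans ?_)
  rw [exp_neg_pow hq]
  exact pow_le_pow_left₀ (by norm_num) Real.exp_neg_one_gt_d9.le m

lemma exp_neg_le {c q : ℝ} {m n : ℕ} (hc : 0 ≤ c) (hn : n ≠ 0) (hq : n * q = m)
    (h : (0.3678794412 : ℝ) ^ m ≤ c ^ n) : Real.exp (-q) ≤ c := by
  refine (pow_le_pow_iff_left₀ (Real.exp_pos _).le hc hn).1 (le_trans ?_ h)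
  rw [exp_neg_pow hq]
  exact pow_le_pow_left₀ (Real.exp_pos _).le Real.exp_neg_one_lt_d9.le m

lemma rpow_log_inv_le_pow {c t : ℝ} {m n : ℕ} (hc : 0 ≤ c) (hn : n ≠ 0)
    (h : c ^ n ≤ (0.36787944116 : ℝ) ^ m) (ht : 0 < t) (ht' : t ^ n ≤ 1) :
    c ^ Real.log (1 / t ^ n) ≤ t ^ m := by
  have hn' : (n : ℝ) ≠ 0 := Nat.cast_ne_zero.2 hn
  have hL : 0 ≤ Real.log (1 / t ^ n) := Real.log_nonneg (one_le_one_div (by positivity) ht')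
  refine (Real.rpow_le_rpow hc (le_exp_neg hc hn (mul_div_cancel₀ _ hn') h) hL).trans_eq ?_
  rw [← Real.exp_mul, one_div, Real.log_inv, Real.log_pow, ← Real.exp_log (pow_pos ht m),
    Real.log_pow]
  congr 1
  field_simp

lemma exists_pos_pow_eq {ε : ℝ} (hε : 0 < ε) {n : ℕ} (hn : n ≠ 0) : ∃ t : ℝ, 0 < t ∧ t ^ n = ε :=
  ⟨ε ^ (n : ℝ)⁻¹, Real.rpow_pos_of_pos hε _, Real.rpow_inv_natCast_pow hε.le hn⟩

/-- The power is at most `ε ^ (3 / 2)`, and `√ε ≤ (1 + 20 * ε) / (2 * √20)` by AM-GM. -/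
lemma rpow_log_inv_le_quadratic {ε : ℝ} (hε : 0 < ε) (hε' : ε ≤ 1 / 20) :
    (11 / 50 : ℝ) ^ Real.log (1 / ε) ≤ 0.1073 * (ε * (1 + 20 * ε)) := by
  obtain ⟨t, ht, rfl⟩ := exists_pos_pow_eq hε (n := 72) (by norm_num)
  have ht' : t ≤ 0.9593 := by
    refine (pow_le_pow_iff_left₀ ht.le (by norm_num) (n := 72) (by norm_num)).1 (hε'.trans ?_)
    norm_num
  have hsqrt : t ^ 36 ≤ 0.111805 * (1 + 20 * t ^ 72) := by
    nlinarith [sq_nonneg (t ^ 36 - 0.2236)]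
  calc (11 / 50 : ℝ) ^ Real.log (1 / t ^ 72) ≤ t ^ 109 :=
        rpow_log_inv_le_pow (by norm_num) (by norm_num) (by norm_num) ht (by linarith)
    _ = t ^ 72 * (t ^ 36 * t) := by ring
    _ ≤ t ^ 72 * (0.111805 * (1 + 20 * t ^ 72) * 0.9593) := by gcongr
    _ = 0.111805 * 0.9593 * (t ^ 72 * (1 + 20 * t ^ 72)) := by ring
    _ ≤ 0.1073 * (t ^ 72 * (1 + 20 * t ^ 72)) := by gcongr; norm_num

lemma exp_neg_pow_floor_logb_bounds {B ε : ℝ} (hB : 1 < B) (hε : 0 < ε) (hε' : ε < 1 / 20) :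
    ε ≤ Real.exp (-B ^ ⌊Real.logb B (Real.log (1 / ε))⌋₊) ∧
      Real.exp (-B ^ (⌊Real.logb B (Real.log (1 / ε))⌋₊ + 1)) ≤ ε := by
  have hL : 1 ≤ Real.log (1 / ε) := by
    rw [Real.le_log_iff_exp_le (by positivity), le_div_iff₀ hε]
    linarith [mul_le_mul_of_nonneg_right Real.exp_one_lt_d9.le hε.le]
  have hL0 : 0 < Real.log (1 / ε) := by linarith
  have hεL : ε = Real.exp (-Real.log (1 / ε)) := by
    rw [one_div, Real.log_inv, neg_neg, Real.exp_log hε]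
  have hlow := Nat.floor_le (Real.logb_nonneg hB hL)
  have hup := (Nat.lt_floor_add_one (Real.logb B (Real.log (1 / ε)))).le
  rw [Real.le_logb_iff_rpow_le hB hL0, Real.rpow_natCast] at hlow
  rw [Real.logb_le_iff_le_rpow hB hL0] at hup
  generalize ⌊Real.logb B (Real.log (1 / ε))⌋₊ = k at hlow hup
  constructor
  · exact hεL.trans_le (Real.exp_le_exp.2 (neg_le_neg hlow))
  · refine (Real.exp_le_exp.2 (neg_le_neg ?_)).trans_eq hεL.symm
    exact_mod_cast hup

end ExpBounds

/-- Below the threshold `t`, the constant errors of a step may dominate `w ^ b`, so that only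
`t ^ b` is guaranteed. -/
lemma le_max_pow_of_step {l v : ℕ → ℝ} {a b j : ℕ} {c t W : ℝ} (hc : 0 ≤ c) (ht : 0 ≤ t)
    (htW : t ≤ W) (hta : t ^ b ≤ c * t ^ a) (hv : ∀ i, 0 ≤ v i) (hvW : ∀ i, v i ≤ W)
    (hva : ∀ i, v i ^ b ≤ c * v (i + 1) ^ a)
    (hstep : ∀ k w, t ≤ w → w ≤ W → l k ≤ c * w ^ a → l (k + 1) ≤ w ^ b)
    (h0 : l j ≤ c * v 0 ^ a) (i : ℕ) : l (j + i + 1) ≤ max t (v i) ^ b := by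
  have hmono : ∀ i, c * v i ^ a ≤ c * max t (v i) ^ a := fun i =>
    mul_le_mul_of_nonneg_left (pow_le_pow_left₀ (hv i) (le_max_right _ _) a) hc
  induction i with
  | zero => exact hstep j _ (le_max_left _ _) (max_le htW (hvW 0)) (h0.trans (hmono 0))
  | succ i ih =>
    refine hstep _ _ (le_max_left _ _) (max_le htW (hvW _)) (ih.trans ?_)
    rcases le_total t (v i) with h | h
    · rw [max_eq_right h]
      exact (hva i).trans (hmono (i + 1))
    · rw [max_eq_left h]
      exact hta.trans (mul_le_mul_of_nonneg_left (pow_le_pow_left₀ ht (le_max_left _ _) a) hc)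

/-- The comparison sequence is `v i = q * exp (-B ^ (i + s + 1) / b)`: as `b = a * B`, its powers
`v i ^ b` and `v (i + 1) ^ a` have the same exponential factor. -/
lemma le_pow_of_step_of_exp_le {l : ℕ → ℝ} {a b j s : ℕ} {B c q t W : ℝ} (hB : 1 ≤ B) (hb : b ≠ 0)
    (hab : a * B = b) (hq : 0 ≤ q) (hq' : q ≤ 1) (hqc : q ^ b ≤ c * q ^ a)
    (hqW : q * Real.exp (-(B ^ (s + 1) / b)) ≤ W) (hc : 0 ≤ c) (ht : 0 ≤ t) (htW : t ≤ W)
    (hta : t ^ b ≤ c * t ^ a)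
    (hstep : ∀ k w, t ≤ w → w ≤ W → l k ≤ c * w ^ a → l (k + 1) ≤ w ^ b)
    (h0 : l j ≤ c * (q ^ a * Real.exp (-B ^ s))) {i : ℕ}
    (hi : Real.exp (-B ^ (i + s + 1)) ≤ t ^ b) : l (j + i + 1) ≤ t ^ b := by
  have hb' : (b : ℝ) ≠ 0 := Nat.cast_ne_zero.2 hb
  set v : ℕ → ℝ := fun i => q * Real.exp (-(B ^ (i + s + 1) / b)) with hv
  have hvb : ∀ i, v i ^ b = q ^ b * Real.exp (-B ^ (i + s + 1)) := fun i => by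
    rw [hv, mul_pow, ← Real.exp_nat_mul]
    congr 2
    field_simp
  have hva : ∀ i, v i ^ a = q ^ a * Real.exp (-B ^ (i + s)) := fun i => by
    rw [hv, mul_pow, ← Real.exp_nat_mul]
    congr 2
    field_simp
    rw [← hab]
    ring
  have hvW : ∀ i, v i ≤ W := fun i => by
    have : B ^ (s + 1) ≤ B ^ (i + s + 1) := pow_le_pow_right₀ hB (by lia)
    refine le_trans ?_ hqW
    simp only [hv]
    gcongr
  have hv_succ : ∀ i, v i ^ b ≤ c * v (i + 1) ^ a := fun i => by
    rw [hvb, hva, ← mul_assoc, add_right_comm i s 1]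
    gcongr
  refine (le_max_pow_of_step hc ht htW hta (fun i => by positivity) hvW hv_succ hstep
    (by rwa [hva, zero_add]) i).trans_eq ?_
  rw [max_eq_left]
  refine (pow_le_pow_iff_left₀ (by positivity) ht hb).1 ((hvb i).trans_le ?_)
  exact (mul_le_of_le_one_left (Real.exp_pos _).le (pow_le_one₀ hq hq')).trans hi

namespace DecrementRecursion

variable {l : ℕ → ℝ} {δ δ₂ t : ℝ}

section Superlinear

lemma succ_le_pow_six (h : DecrementRecursion l δ δ₂) {w : ℝ} (hw : 0 ≤ w) (hw' : w ≤ 0.431)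
    (hδ : δ ≤ 1 / 4 * w ^ 3) (hδ₂ : δ₂ ≤ 37 / 20 * w ^ 9) {k : ℕ} (hk : l k ≤ 1 / 2 * w ^ 4) :
    l (k + 1) ≤ w ^ 6 := by
  have hw2 : w ^ 2 ≤ 0.186 := (pow_le_pow_left₀ hw hw' 2).trans (by norm_num)
  have hw3 : w ^ 3 ≤ 0.0801 := (pow_le_pow_left₀ hw hw' 3).trans (by norm_num)
  have hw4 : w ^ 4 ≤ 0.035 := (pow_le_pow_left₀ hw hw' 4).trans (by norm_num)
  calc l (k + 1)
    _ ≤ 224 / 100 * (1 / 2 * w ^ 4) ^ 2 + 8 * δ * (1 / 2 * w ^ 4) + 21 / 10 * δ₂ :=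
        h.succ_le_of_le hk (by linarith)
    _ ≤ 224 / 100 * (1 / 2 * w ^ 4) ^ 2 + 8 * (1 / 4 * w ^ 3) * (1 / 2 * w ^ 4) +
          21 / 10 * (37 / 20 * w ^ 9) := by gcongr
    _ = w ^ 6 * (56 / 100 * w ^ 2 + w + 3885 / 1000 * w ^ 3) := by ring
    _ ≤ w ^ 6 := mul_le_of_le_one_right (by positivity) (by linarith)

lemma le_pow_six_at_three (h : DecrementRecursion l δ δ₂) (hb : ∀ k, l k ≤ 1 / 20)
    (ht : 0 < t) (hε : 0.0063 ≤ t ^ 6) (hε' : t ^ 6 ≤ 0.0343) (hδ₂ : δ₂ ≤ 37 / 20 * t ^ 9) :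
    l 3 ≤ t ^ 6 := by
  have ht3 : t ^ 3 ≤ 0.1853 := by
    refine (sq_le_sq₀ (by positivity) (by norm_num)).1 ?_
    calc (t ^ 3) ^ 2 = t ^ 6 := by ring
      _ ≤ 0.1853 ^ 2 := hε'.trans (by norm_num)
  have hδ₂ε : δ₂ ≤ 37 / 20 * (0.1853 * t ^ 6) := by
    refine hδ₂.trans (mul_le_mul_of_nonneg_left ?_ (by norm_num))
    calc t ^ 9 = t ^ 3 * t ^ 6 := by ring
      _ ≤ 0.1853 * t ^ 6 := by gcongr
  have hδ := h.delta_le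
  have hstep : ∀ k b, l k ≤ b → b ≤ 1 / 20 →
      l (k + 1) ≤ 224 / 100 * (b * l k) + 8 / 100 * l k + 21 / 10 * δ₂ := by
    intro k b hkb hb'
    have h0 := h.nonneg k
    have : l k ^ 2 ≤ b * l k := by rw [sq]; gcongr
    have : δ * l k ≤ 1 / 100 * l k := by gcongr
    linarith [h.succ_le (hkb.trans hb')]
  have h1 := hstep 0 _ (hb 0) le_rfl
  have h2 := hstep 1 _ (hb 1) le_rfl
  have h3 := hstep 2 0.0314 (by linarith [hb 0]) (by norm_num)
  linarith [hb 0]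

lemma le_pow_six_of_exp_le (h : DecrementRecursion l δ δ₂) (h0 : l 0 ≤ 1 / 20) (ht : 0 < t)
    (hε : t ^ 6 ≤ 0.0064) (hδ : δ ≤ 1 / 4 * t ^ 3) (hδ₂ : δ₂ ≤ 37 / 20 * t ^ 9) {i : ℕ}
    (hi : Real.exp (-(3 / 2) ^ (i + 3)) ≤ t ^ 6) : l (i + 2) ≤ t ^ 6 := by
  have htW : t ≤ 0.431 :=
    (pow_le_pow_iff_left₀ ht.le (by norm_num) (n := 6) (by norm_num)).1 (hε.trans (by norm_num))
  have htab : t ^ 6 ≤ 1 / 2 * t ^ 4 := by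
    have : t ^ 2 ≤ 0.431 ^ 2 := by gcongr
    calc t ^ 6 = t ^ 2 * t ^ 4 := by ring
      _ ≤ 1 / 2 * t ^ 4 := by gcongr; linarith
  have hv0 : 0.7 * Real.exp (-((3 / 2) ^ 3 / (6 : ℕ))) ≤ 0.431 := by
    have : Real.exp (-((3 / 2) ^ 3 / (6 : ℕ))) ≤ 0.57 :=
      exp_neg_le (m := 9) (n := 16) (by norm_num) (by norm_num) (by norm_num) (by norm_num)
    linarith
  have hl1 : l 1 ≤ 1 / 2 * (0.7 ^ 4 * Real.exp (-(3 / 2) ^ 2)) := by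
    have : 0.105 ≤ Real.exp (-(3 / 2) ^ 2) :=
      le_exp_neg (m := 9) (n := 4) (by norm_num) (by norm_num) (by norm_num) (by norm_num)
    have : t ^ 9 ≤ 0.431 ^ 3 * 0.0064 := by
      calc t ^ 9 = t ^ 3 * t ^ 6 := by ring
        _ ≤ 0.431 ^ 3 * 0.0064 := by gcongr
    linarith [h.succ_le_of_le h0 le_rfl, h.delta_le]
  rw [show i + 2 = 1 + i + 1 by lia]
  exact le_pow_of_step_of_exp_le (l := l) (a := 4) (b := 6) (s := 2) (by norm_num)
    (by norm_num) (by norm_num) (by norm_num) (by norm_num) (by norm_num) hv0 (by norm_num) ht.le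
    htW htab
    (fun k w htw hw => h.succ_le_pow_six (ht.le.trans htw) hw (hδ.trans (by gcongr))
      (hδ₂.trans (by gcongr))) hl1 hi

lemma superlinear_rate (h : DecrementRecursion l δ δ₂) (h0 : l 0 ≤ 1 / 20) {ε : ℝ} (hε : 0 < ε)
    (hε' : ε < 1 / 20) (hδ : δ ≤ 1 / 4 * (3 / 5 : ℝ) ^ Real.log (1 / ε))
    (hδ₂ : δ₂ ≤ 37 / 20 * (11 / 50 : ℝ) ^ Real.log (1 / ε)) :
    l ⌊Real.logb (3 / 2) (Real.log (1 / ε))⌋₊ ≤ ε := by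
  obtain ⟨hεu, hεl⟩ := exp_neg_pow_floor_logb_bounds (B := 3 / 2) (by norm_num) hε hε'
  have hδ₂q : δ₂ ≤ 37 / 20 * (0.1073 * (ε * (1 + 20 * ε))) :=
    hδ₂.trans (mul_le_mul_of_nonneg_left (rpow_log_inv_le_quadratic hε hε'.le) (by norm_num))
  have hb := h.le_one_div_twenty h0 (by nlinarith)
  obtain ⟨t, ht, rfl⟩ := exists_pos_pow_eq hε (n := 6) (by norm_num)
  have hδt : δ ≤ 1 / 4 * t ^ 3 := hδ.trans (mul_le_mul_of_nonneg_left
    (rpow_log_inv_le_pow (by norm_num) (by norm_num) (by norm_num) ht (by linarith)) (by norm_num))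
  have hδ₂t : δ₂ ≤ 37 / 20 * t ^ 9 := hδ₂.trans (mul_le_mul_of_nonneg_left
    (rpow_log_inv_le_pow (by norm_num) (by norm_num) (by norm_num) ht (by linarith)) (by norm_num))
  generalize ⌊Real.logb (3 / 2) (Real.log (1 / t ^ 6))⌋₊ = k at hεl hεu ⊢
  obtain hk | rfl | rfl | hk : k ≤ 1 ∨ k = 2 ∨ k = 3 ∨ 4 ≤ k := by lia
  · have : (3 / 2 : ℝ) ^ (k + 1) ≤ (3 / 2) ^ 2 := pow_le_pow_right₀ (by norm_num) (by lia)
    have := (Real.exp_le_exp.2 (neg_le_neg this)).trans hεl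
    have : 0.1 ≤ Real.exp (-(3 / 2) ^ 2) :=
      le_exp_neg (m := 9) (n := 4) (by norm_num) (by norm_num) (by norm_num) (by norm_num)
    linarith
  · have : 0.034 ≤ Real.exp (-(3 / 2) ^ 3) :=
      le_exp_neg (m := 27) (n := 8) (by norm_num) (by norm_num) (by norm_num) (by norm_num)
    exact h.succ_le_of_delta2_le (hb 1) (this.trans hεl) hε'.le hδ₂q
  · refine h.le_pow_six_at_three hb ht (le_trans ?_ hεl) (hεu.trans ?_) hδ₂t
    · exact le_exp_neg (m := 81) (n := 16) (by norm_num) (by norm_num) (by norm_num) (by norm_num)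
    · exact exp_neg_le (m := 27) (n := 8) (by norm_num) (by norm_num) (by norm_num) (by norm_num)
  · obtain ⟨i, rfl⟩ := Nat.exists_eq_add_of_le' hk
    have : (3 / 2 : ℝ) ^ 4 ≤ (3 / 2) ^ (i + 4) := pow_le_pow_right₀ (by norm_num) (by lia)
    have : Real.exp (-(3 / 2) ^ 4) ≤ 0.0064 :=
      exp_neg_le (m := 81) (n := 16) (by norm_num) (by norm_num) (by norm_num) (by norm_num)
    have hε : t ^ 6 ≤ 0.0064 := hεu.trans ((Real.exp_le_exp.2 (by linarith)).trans this)
    exact h.le_pow_six_of_exp_le h0 ht hε hδt hδ₂t (i := i + 2) hεl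

end Superlinear

section Quadratic

lemma succ_le_pow_twelve (h : DecrementRecursion l δ δ₂) {w : ℝ} (hw : 0 ≤ w) (hw' : w ≤ 0.52)
    (hδ : δ ≤ 1 / 10 * w ^ 9) (hδ₂ : δ₂ ≤ 1 / 5 * w ^ 16) {k : ℕ} (hk : l k ≤ 6 / 10 * w ^ 6) :
    l (k + 1) ≤ w ^ 12 := by
  have hw3 : w ^ 3 ≤ 0.141 := (pow_le_pow_left₀ hw hw' 3).trans (by norm_num)
  have hw4 : w ^ 4 ≤ 0.074 := (pow_le_pow_left₀ hw hw' 4).trans (by norm_num)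
  have hw6 : w ^ 6 ≤ 0.02 := (pow_le_pow_left₀ hw hw' 6).trans (by norm_num)
  calc l (k + 1)
    _ ≤ 224 / 100 * (6 / 10 * w ^ 6) ^ 2 + 8 * δ * (6 / 10 * w ^ 6) + 21 / 10 * δ₂ :=
        h.succ_le_of_le hk (by linarith)
    _ ≤ 224 / 100 * (6 / 10 * w ^ 6) ^ 2 + 8 * (1 / 10 * w ^ 9) * (6 / 10 * w ^ 6) +
          21 / 10 * (1 / 5 * w ^ 16) := by gcongr
    _ = w ^ 12 * (8064 / 10000 + 48 / 100 * w ^ 3 + 42 / 100 * w ^ 4) := by ring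
    _ ≤ w ^ 12 := mul_le_of_le_one_right (by positivity) (by linarith)

lemma le_pow_sixteen_mul {c : ℝ} (hc : 0 ≤ c) (htc : t ^ 12 ≤ c ^ 3) :
    t ^ 16 ≤ c * t ^ 12 := by
  have : t ^ 4 ≤ c := by
    refine (pow_le_pow_iff_left₀ (by positivity) hc (n := 3) (by norm_num)).1 ?_
    calc (t ^ 4) ^ 3 = t ^ 12 := by ring
      _ ≤ c ^ 3 := htc
  calc t ^ 16 = t ^ 4 * t ^ 12 := by ring
    _ ≤ c * t ^ 12 := by gcongr

lemma mul_pow_nine_le {c : ℝ} (hc : 0 ≤ c) (ht : 0 ≤ t) (htc : c ^ 4 ≤ t ^ 12) :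
    c * t ^ 9 ≤ t ^ 12 := by
  have : c ≤ t ^ 3 := by
    refine (pow_le_pow_iff_left₀ hc (by positivity) (n := 4) (by norm_num)).1 ?_
    calc c ^ 4 ≤ t ^ 12 := htc
      _ = (t ^ 3) ^ 4 := by ring
  calc c * t ^ 9 ≤ t ^ 3 * t ^ 9 := by gcongr
    _ = t ^ 12 := by ring

lemma le_pow_twelve_at_one (h : DecrementRecursion l δ δ₂) (h0 : l 0 ≤ 1 / 20) (ht : 0 < t)
    (hε : 0.0183 ≤ t ^ 12) (hε' : t ^ 12 ≤ 1 / 20) (hδ : δ ≤ 1 / 10 * t ^ 9)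
    (hδ₂ : δ₂ ≤ 1 / 5 * t ^ 16) : l 1 ≤ t ^ 12 := by
  have h9 := mul_pow_nine_le (c := 0.3677) (by norm_num) ht.le (le_trans (by norm_num) hε)
  have h16 := le_pow_sixteen_mul (c := 0.3685) (by norm_num) (hε'.trans (by norm_num))
  linarith [h.succ_le_of_le h0 le_rfl]

lemma le_pow_twelve_at_two (h : DecrementRecursion l δ δ₂) (h0 : l 0 ≤ 1 / 20) (ht : 0 < t)
    (hε : 0.000335 ≤ t ^ 12) (hε' : t ^ 12 ≤ 0.01832) (hδ : δ ≤ 1 / 10 * t ^ 9)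
    (hδ₂ : δ₂ ≤ 1 / 5 * t ^ 16) : l 2 ≤ t ^ 12 := by
  have h9 := mul_pow_nine_le (c := 0.1352) (by norm_num) ht.le (le_trans (by norm_num) hε)
  have h16 := le_pow_sixteen_mul (c := 0.264) (by norm_num) (hε'.trans (by norm_num))
  have h1 : l 1 ≤ 0.0056 + 0.407 * t ^ 12 := by
    linarith [h.succ_le_of_le h0 le_rfl]
  have h1' : l 1 ≤ 0.0131 := by linarith
  have hl := h.nonneg 1
  have hδ0 := h.delta_nonneg
  have : l 1 ^ 2 ≤ 0.0131 * l 1 := by rw [sq]; gcongr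
  have : 8 * δ * l 1 ≤ 8 * δ * 0.0131 := by gcongr
  linarith [h.succ_le (by linarith : l 1 ≤ 1 / 20)]

lemma le_pow_twelve_of_exp_le (h : DecrementRecursion l δ δ₂) (h0 : l 0 ≤ 1 / 20) (ht : 0 < t)
    (hε : t ^ 12 ≤ 0.000336) (hδ : δ ≤ 1 / 10 * t ^ 9) (hδ₂ : δ₂ ≤ 1 / 5 * t ^ 16) {i : ℕ}
    (hi : Real.exp (-2 ^ (i + 3)) ≤ t ^ 12) : l (i + 2) ≤ t ^ 12 := by
  have htW : t ≤ 0.52 :=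
    (pow_le_pow_iff_left₀ ht.le (by norm_num) (n := 12) (by norm_num)).1 (hε.trans (by norm_num))
  have htab : t ^ 12 ≤ 6 / 10 * t ^ 6 := by
    have : t ^ 6 ≤ 0.52 ^ 6 := by gcongr
    calc t ^ 12 = t ^ 6 * t ^ 6 := by ring
      _ ≤ 6 / 10 * t ^ 6 := by gcongr; linarith
  have hv0 : 0.91 * Real.exp (-(2 ^ 3 / (12 : ℕ))) ≤ 0.52 := by
    have : Real.exp (-(2 ^ 3 / (12 : ℕ))) ≤ 0.57 :=
      exp_neg_le (m := 2) (n := 3) (by norm_num) (by norm_num) (by norm_num) (by norm_num)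
    linarith
  have hl1 : l 1 ≤ 6 / 10 * (0.91 ^ 6 * Real.exp (-2 ^ 2)) := by
    have : 0.018 ≤ Real.exp (-2 ^ 2) :=
      le_exp_neg (m := 4) (n := 1) (by norm_num) (by norm_num) (by norm_num) (by norm_num)
    have : t ^ 9 ≤ 0.52 ^ 9 := by gcongr
    have : t ^ 16 ≤ 0.52 ^ 16 := by gcongr
    linarith [h.succ_le_of_le h0 le_rfl]
  rw [show i + 2 = 1 + i + 1 by lia]
  exact le_pow_of_step_of_exp_le (l := l) (a := 6) (b := 12) (s := 2) (by norm_num)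
    (by norm_num) (by norm_num) (by norm_num) (by norm_num) (by norm_num) hv0 (by norm_num) ht.le
    htW htab
    (fun k w htw hw => h.succ_le_pow_twelve (ht.le.trans htw) hw (hδ.trans (by gcongr))
      (hδ₂.trans (by gcongr))) hl1 hi

lemma quadratic_rate (h : DecrementRecursion l δ δ₂) (h0 : l 0 ≤ 1 / 20) {ε : ℝ} (hε : 0 < ε)
    (hε' : ε < 1 / 20) (hδ : δ ≤ 1 / 10 * (19 / 50 : ℝ) ^ Real.log (1 / ε))
    (hδ₂ : δ₂ ≤ 1 / 5 * (13 / 50 : ℝ) ^ Real.log (1 / ε)) :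
    l ⌊Real.logb 2 (Real.log (1 / ε))⌋₊ ≤ ε := by
  obtain ⟨hεu, hεl⟩ := exp_neg_pow_floor_logb_bounds (B := 2) (by norm_num) hε hε'
  obtain ⟨t, ht, rfl⟩ := exists_pos_pow_eq hε (n := 12) (by norm_num)
  have hδt : δ ≤ 1 / 10 * t ^ 9 := hδ.trans (mul_le_mul_of_nonneg_left
    (rpow_log_inv_le_pow (by norm_num) (by norm_num) (by norm_num) ht (by linarith)) (by norm_num))
  have hδ₂t : δ₂ ≤ 1 / 5 * t ^ 16 := hδ₂.trans (mul_le_mul_of_nonneg_left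
    (rpow_log_inv_le_pow (by norm_num) (by norm_num) (by norm_num) ht (by linarith)) (by norm_num))
  generalize ⌊Real.logb 2 (Real.log (1 / t ^ 12))⌋₊ = k at hεl hεu ⊢
  obtain rfl | rfl | rfl | hk : k = 0 ∨ k = 1 ∨ k = 2 ∨ 3 ≤ k := by lia
  · have : 0.1 ≤ Real.exp (-2 ^ (0 + 1)) :=
      le_exp_neg (m := 2) (n := 1) (by norm_num) (by norm_num) (by norm_num) (by norm_num)
    linarith [this.trans hεl]
  · refine h.le_pow_twelve_at_one h0 ht (le_trans ?_ hεl) hε'.le hδt hδ₂t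
    exact le_exp_neg (m := 4) (n := 1) (by norm_num) (by norm_num) (by norm_num) (by norm_num)
  · refine h.le_pow_twelve_at_two h0 ht (le_trans ?_ hεl) (hεu.trans ?_) hδt hδ₂t
    · exact le_exp_neg (m := 8) (n := 1) (by norm_num) (by norm_num) (by norm_num) (by norm_num)
    · exact exp_neg_le (m := 4) (n := 1) (by norm_num) (by norm_num) (by norm_num) (by norm_num)
  · obtain ⟨i, rfl⟩ := Nat.exists_eq_add_of_le' hk
    have : (2 : ℝ) ^ 3 ≤ 2 ^ (i + 3) := pow_le_pow_right₀ (by norm_num) (by lia)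
    have : Real.exp (-2 ^ 3) ≤ 0.000336 :=
      exp_neg_le (m := 8) (n := 1) (by norm_num) (by norm_num) (by norm_num) (by norm_num)
    have hε : t ^ 12 ≤ 0.000336 := hεu.trans ((Real.exp_le_exp.2 (by linarith)).trans this)
    exact h.le_pow_twelve_of_exp_le h0 ht hε hδt hδ₂t (i := i + 1) hεl

end Quadratic

end DecrementRecursion

section Residual

variable {p : ℕ} {Df DR X : Set (Vec p)} {f R ftil : Vec p → ℝ} {g : Vec p → Vec p}
  {H : Vec p → Op p} {δ₀ δ₁ δ₂ δ₃ : ℝ} {w y : Vec p}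

lemma omega_nonneg {τ : ℝ} (hτ : 0 ≤ τ) : 0 ≤ omega τ := by
  have := Real.log_le_sub_one_of_pos (by linarith : 0 < 1 + τ)
  rw [omega]
  linarith

lemma omegaStar_le {τ : ℝ} (hτ : τ ≤ 1 / 2) : omegaStar τ ≤ 2 * τ ^ 2 := by
  have hpos : 0 < 1 - τ := by linarith
  have hlog := Real.one_sub_inv_le_log_of_pos hpos
  have hinv : (1 - τ)⁻¹ ≤ 1 + τ + 2 * τ ^ 2 := by
    rw [inv_le_iff_one_le_mul₀ hpos]
    nlinarith [mul_nonneg (sq_nonneg τ) (by linarith : 0 ≤ 1 / 2 - τ)]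
  rw [omegaStar]
  linarith

lemma StandardSelfConcordant.add_inner_gradient_le (hsc : StandardSelfConcordant Df f)
    (hw : w ∈ Df) (hy : y ∈ Df) : f w + inner ℝ (gradient f w) (y - w) ≤ f y := by
  have hmem_zero : w + (0 : ℝ) • (y - w) ∈ Df := by simpa using hw
  have hmem_one : w + (1 : ℝ) • (y - w) ∈ Df := by simpa using hy
  have hslope := (hsc.onLines w hw (y - w)).convexOn.le_slope_of_hasDerivAt hmem_zero hmem_one
    zero_lt_one (hsc.hasDerivAt_comp_line (y - w) hmem_zero)
  rw [slope_def_field] at hslope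
  simp only [zero_smul, add_zero, one_smul, add_sub_cancel, sub_zero, div_one] at hslope
  rw [inner_gradient_left]
  linarith

lemma StandardSelfConcordant.gradient_add_mem_subdifferential (hsc : StandardSelfConcordant Df f)
    (hy : y ∈ Df) {s : Vec p} (hs : s ∈ subdifferential DR R y) :
    gradient f y + s ∈ subdifferential (Df ∩ DR) (fun u => f u + R u) y := by
  refine ⟨⟨hy, hs.1⟩, fun u hu => ?_⟩
  have hf := hsc.add_inner_gradient_le hy hu.1
  have hR := hs.2 u hu.2
  rw [inner_add_left]
  linarith

namespace LocalInexactOracle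

lemma sub_sub_inner_le (ho : LocalInexactOracle Df f X ftil g H δ₀ δ₁ δ₂ δ₃) (hw : w ∈ X)
    {r : ℝ} {y' : Vec p} (hy : weightedNorm (H w) (y - w) ≤ r)
    (hy' : weightedNorm (H w) (y' - w) ≤ r) (hr : (1 + δ₀) * r ≤ 1 / 2) :
    f y' - f y - inner ℝ (g w) (y' - y) ≤ 8 * r ^ 2 + δ₁ := by
  have hδ₀ := ho.delta0_nonneg
  have hδ₀' := ho.delta0_lt_one
  have hball : r < 1 / (1 + δ₀) := by rw [lt_div_iff₀ (by linarith)]; linarith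
  have hlow := ho.lower w hw y (hy.trans_lt hball)
  have hupp := ho.upper w hw y' (hy'.trans_lt hball)
  have hω := omega_nonneg (mul_nonneg (sub_nonneg.2 hδ₀'.le) (weightedNorm_nonneg (H w) (y - w)))
  have hτ0 := weightedNorm_nonneg (H w) (y' - w)
  have hτ : (1 + δ₀) * weightedNorm (H w) (y' - w) ≤ (1 + δ₀) * r := by gcongr
  have hω' : omegaStar ((1 + δ₀) * weightedNorm (H w) (y' - w)) ≤ 8 * r ^ 2 :=
    calc omegaStar ((1 + δ₀) * weightedNorm (H w) (y' - w))
      _ ≤ 2 * ((1 + δ₀) * weightedNorm (H w) (y' - w)) ^ 2 := omegaStar_le (hτ.trans hr)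
      _ ≤ 2 * (2 * r) ^ 2 := by gcongr; linarith
      _ = 8 * r ^ 2 := by ring
  have hinner : inner ℝ (g w) (y' - y) = inner ℝ (g w) (y' - w) - inner ℝ (g w) (y - w) := by
    rw [← inner_sub_right, sub_sub_sub_cancel_right]
  linarith

/-- Moving a distance `ρ` away from `y` turns the bounds on the function values into a bound on
the gradient, by convexity. -/
lemma dualNorm_gradient_sub_le (ho : LocalInexactOracle Df f X ftil g H δ₀ δ₁ δ₂ δ₃)
    (hsc : StandardSelfConcordant Df f) (hw : w ∈ X) {ρ : ℝ} (hρ : 0 < ρ)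
    (hr : (1 + δ₀) * (weightedNorm (H w) (y - w) + ρ) ≤ 1 / 2) :
    dualNorm (H w) (gradient f y - g w) ≤
      (8 * (weightedNorm (H w) (y - w) + ρ) ^ 2 + δ₁) / ρ := by
  have hA := ho.posDef w hw
  have hδ₀ := ho.delta0_nonneg
  have hball : weightedNorm (H w) (y - w) + ρ < 1 / (1 + δ₀) := by
    rw [lt_div_iff₀ (by linarith)]
    linarith
  refine hA.dualNorm_le_div hρ fun u hu => ?_
  have hy : weightedNorm (H w) (y - w) ≤ weightedNorm (H w) (y - w) + ρ := by linarith
  have hy' : weightedNorm (H w) (y + u - w) ≤ weightedNorm (H w) (y - w) + ρ := by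
    rw [add_sub_right_comm]
    exact (hA.weightedNorm_add_le _ _).trans (by gcongr)
  have hgap := ho.sub_sub_inner_le hw hy hy' hr
  have hconv := hsc.add_inner_gradient_le (ho.mem_dom w hw _ (hy.trans_lt hball))
    (ho.mem_dom w hw _ (hy'.trans_lt hball))
  rw [add_sub_cancel_left] at hgap hconv
  rw [inner_sub_left]
  linarith

lemma dualNorm_gradient_sub_le_mul_of_pos (ho : LocalInexactOracle Df f X ftil g H δ₀ δ₁ δ₂ δ₃)
    (hsc : StandardSelfConcordant Df f) (hw : w ∈ X) {S : ℝ} (hS : 0 < S) (hS' : S ≤ 2)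
    (hy : weightedNorm (H w) (y - w) ≤ 1 / (4 * (1 + δ₀)))
    (hyS : weightedNorm (H w) (y - w) ≤ S) (hδ₁ : δ₁ ≤ S ^ 2) :
    dualNorm (H w) (gradient f y - g w) ≤ 161 * S := by
  have hδ₀ := ho.delta0_nonneg
  have hδ₀' := ho.delta0_lt_one
  have hlam := weightedNorm_nonneg (H w) (y - w)
  rw [le_div_iff₀ (by linarith)] at hy
  have hρ : (1 + δ₀) * (S / 16) ≤ 2 * (2 / 16) := by gcongr; linarith
  calc dualNorm (H w) (gradient f y - g w)
    _ ≤ (8 * (weightedNorm (H w) (y - w) + S / 16) ^ 2 + δ₁) / (S / 16) :=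
        ho.dualNorm_gradient_sub_le hsc hw (by positivity) (by linarith)
    _ ≤ (8 * (S + S / 16) ^ 2 + S ^ 2) / (S / 16) := by gcongr
    _ = 321 / 2 * S := by field_simp; norm_num
    _ ≤ 161 * S := by gcongr; norm_num

lemma dualNorm_gradient_sub_le_mul (ho : LocalInexactOracle Df f X ftil g H δ₀ δ₁ δ₂ δ₃)
    (hsc : StandardSelfConcordant Df f) (hw : w ∈ X)
    (hy : weightedNorm (H w) (y - w) ≤ 1 / (4 * (1 + δ₀))) (hδ₁ : δ₁ ≤ 1) :
    dualNorm (H w) (gradient f y - g w) ≤ 161 * (weightedNorm (H w) (y - w) + √δ₁) := by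
  have hδ₀ := ho.delta0_nonneg
  have hlam := weightedNorm_nonneg (H w) (y - w)
  have hlam' : weightedNorm (H w) (y - w) ≤ 1 / 4 :=
    hy.trans (one_div_le_one_div_of_le (by norm_num) (by linarith))
  have hsqrt := Real.sqrt_nonneg δ₁
  have hsqrt' : √δ₁ ≤ 1 := Real.sqrt_le_one.2 hδ₁
  refine le_of_forall_pos_le_add fun ε hε => ?_
  have hη : 0 < min (1 / 2) (ε / 161) := by positivity
  have hη_half := min_le_left (1 / 2) (ε / 161)
  have hη_ε := min_le_right (1 / 2) (ε / 161)
  have hδ₁S : δ₁ ≤ (weightedNorm (H w) (y - w) + √δ₁ + min (1 / 2) (ε / 161)) ^ 2 :=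
    (Real.sqrt_le_left (by positivity)).1 (by linarith)
  have := ho.dualNorm_gradient_sub_le_mul_of_pos hsc hw (by positivity) (by linarith) hy
    (by linarith) hδ₁S
  linarith

lemma subgradientResidual_le (ho : LocalInexactOracle Df f X ftil g H δ₀ δ₁ δ₂ δ₃)
    (hsc : StandardSelfConcordant Df f) {ν : Vec p} (hw : w ∈ X)
    (hν : dualNorm (H w) ν ≤ weightedNorm (H w) (y - w))
    (hs : ν - (g w + H w (y - w)) ∈ subdifferential DR R y)
    (hy : weightedNorm (H w) (y - w) ≤ 1 / (4 * (1 + δ₀))) (hδ₁ : δ₁ ≤ 1) :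
    (subdifferential (Df ∩ DR) (fun u => f u + R u) y).Nonempty ∧
      subgradientResidual Df f DR R (H w) y ≤ 163 * (weightedNorm (H w) (y - w) + √δ₁) := by
  have hA := ho.posDef w hw
  have hδ₀ := ho.delta0_nonneg
  have hyD : y ∈ Df := ho.mem_dom w hw y
    (hy.trans_lt (one_div_lt_one_div_of_lt (by linarith) (by linarith)))
  have hmem := hsc.gradient_add_mem_subdifferential hyD hs
  refine ⟨⟨_, hmem⟩, ?_⟩
  have hbdd : BddBelow (dualNorm (H w) '' subdifferential (Df ∩ DR) (fun u => f u + R u) y) :=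
    ⟨0, Set.forall_mem_image.2 fun v _ => dualNorm_nonneg (H w) v⟩
  calc subgradientResidual Df f DR R (H w) y
    _ ≤ dualNorm (H w) (gradient f y + (ν - (g w + H w (y - w)))) :=
        csInf_le hbdd (Set.mem_image_of_mem _ hmem)
    _ = dualNorm (H w) (gradient f y - g w + (ν - H w (y - w))) := by congr 1; abel
    _ ≤ dualNorm (H w) (gradient f y - g w) + (dualNorm (H w) ν + weightedNorm (H w) (y - w)) := by
        rw [← hA.dualNorm_apply]
        exact (hA.dualNorm_add_le _ _).trans (by gcongr; exact hA.dualNorm_sub_le _ _)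
    _ ≤ 163 * (weightedNorm (H w) (y - w) + √δ₁) := by
        linarith [ho.dualNorm_gradient_sub_le_mul hsc hw hy hδ₁, Real.sqrt_nonneg δ₁]

end LocalInexactOracle

end Residual

section Algorithm

variable {p : ℕ} {Df DR X : Set (Vec p)} {f R ftil : Vec p → ℝ} {g : Vec p → Vec p}
  {H : Vec p → Op p} {δ₀ δ₁ δ₂ δ₃ δ₄ : ℝ} {x z : ℕ → Vec p}

lemma IsDampedIPNA.isInexactProxNewtonPoint (hip : IsDampedIPNA DR R g H δ₀ δ₄ x z)
    (hsc : StandardSelfConcordant Df f) (ho : LocalInexactOracle Df f X ftil g H δ₀ δ₁ δ₂ δ₃)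
    (h3 : δ₃ ≤ δ₀) (h4 : δ₄ ≤ δ₀) {k : ℕ} (hk : x k ∈ X) :
    IsInexactProxNewtonPoint f DR R δ₀ δ₂ (x k) (H (x k)) (z k) where
  hessianApprox :=
    (IsHessianApprox.of_loewner (hsc.contDiffAt_two (ho.subset_dom hk)) (ho.posDef _ hk)
      ho.delta3_nonneg ho.delta3_lt_one (ho.hessian_lower _ hk) (ho.hessian_upper _ hk)).mono
      h3 ho.delta0_lt_one
  optimality := by
    obtain ⟨ν, hs, hν⟩ := hip.stopping k
    refine ⟨ν - (g (x k) - gradient f (x k)), ?_, ?_⟩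
    · rwa [sub_sub, ← add_assoc, sub_add_cancel]
    · calc dualNorm (H (x k)) (ν - (g (x k) - gradient f (x k)))
        _ ≤ dualNorm (H (x k)) ν + dualNorm (H (x k)) (g (x k) - gradient f (x k)) :=
            (ho.posDef _ hk).dualNorm_sub_le _ _
        _ ≤ δ₄ * weightedNorm (H (x k)) (z k - x k) + δ₂ :=
            add_le_add hν (ho.gradient_error _ hk)
        _ ≤ δ₀ * weightedNorm (H (x k)) (z k - x k) + δ₂ := by
            gcongr
            exact weightedNorm_nonneg _ _

lemma IsDampedIPNA.decrementRecursion (hip : IsDampedIPNA DR R g H δ₀ δ₄ x z)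
    (hsc : StandardSelfConcordant Df f) (ho : LocalInexactOracle Df f X ftil g H δ₀ δ₁ δ₂ δ₃)
    (hX : ∀ k, x k ∈ X) (h3 : δ₃ ≤ δ₀) (h4 : 0 ≤ δ₄) (h4' : δ₄ ≤ δ₀) (hδ : δ₀ ≤ 1 / 100) :
    DecrementRecursion (decrement H x z) δ₀ δ₂ where
  nonneg _ := weightedNorm_nonneg _ _
  delta_nonneg := ho.delta0_nonneg
  delta_le := hδ
  delta2_nonneg := ho.delta2_nonneg
  succ_sq_le k hk :=
    (hip.isInexactProxNewtonPoint hsc ho h3 h4' (hX k)).weightedNorm_sq_le_of_dampedStep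
      (hip.isInexactProxNewtonPoint hsc ho h3 h4' (hX (k + 1))) hsc (ho.mem_dom _ (hX k)) h4 h4' hδ
      (hip.step k) rfl rfl ho.delta2_nonneg hk

end Algorithm

end InexactProxNewton

theorem theorem4p4_general {p : ℕ} {Df DR X : Set (Vec p)} {f R ftil : Vec p → ℝ}
    {g : Vec p → Vec p} {H : Vec p → Op p} {δ₀ δ₁ δ₂ δ₃ δ₄ : ℝ} {x z : ℕ → Vec p}
    (hsc : StandardSelfConcordant Df f) (ho : LocalInexactOracle Df f X ftil g H δ₀ δ₁ δ₂ δ₃)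
    (h4 : 0 ≤ δ₄) (h4' : δ₄ < 1) (hip : IsDampedIPNA DR R g H δ₀ δ₄ x z) (hX : ∀ k, x k ∈ X) :
    (∀ δ : ℝ, δ₃ ≤ δ → δ₄ ≤ δ → δ ≤ 1 / 100 → δ₀ = δ →
      (∀ k, decrement H x z k ≤ 1 / 20 →
        decrement H x z (k + 1) ≤
          (41 * decrement H x z k ^ 2 + 125 * δ * decrement H x z k + 21 * δ₂) / 10) ∧
      (∀ ε : ℝ, 0 < ε → ε < 1 / 20 → decrement H x z 0 ≤ 1 / 20 →
        (δ₂ = 5 * ε / 32 → decrement H x z ⌊Real.log (1 / ε)⌋₊ ≤ ε) ∧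
        (δ ≤ 1 / 4 * (3 / 5 : ℝ) ^ Real.log (1 / ε) →
          δ₂ ≤ 37 / 20 * (11 / 50 : ℝ) ^ Real.log (1 / ε) →
          decrement H x z ⌊Real.logb (3 / 2) (Real.log (1 / ε))⌋₊ ≤ ε) ∧
        (δ ≤ 1 / 10 * (19 / 50 : ℝ) ^ Real.log (1 / ε) →
          δ₂ ≤ 1 / 5 * (13 / 50 : ℝ) ^ Real.log (1 / ε) →
          decrement H x z ⌊Real.logb 2 (Real.log (1 / ε))⌋₊ ≤ ε))) ∧
    (∀ k, decrement H x z k ≤ 1 / (4 * (1 + δ₀)) → δ₁ ≤ 1 →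
      (subdifferential (Df ∩ DR) (fun u => f u + R u) (z k)).Nonempty ∧
      subgradientResidual Df f DR R (H (x k)) (z k) ≤ 163 * (decrement H x z k + √δ₁)) ∧
    (∀ c₁ c₂ ε : ℝ, 0 < ε → ∀ k,
      decrement H x z k ≤ c₁ * ε → c₁ * ε ≤ 1 / (4 * (1 + δ₀)) →
      δ₁ ≤ c₂ * ε ^ 2 → c₂ * ε ^ 2 ≤ 1 →
      subgradientResidual Df f DR R (H (x k)) (z k) ≤ 163 * (c₁ + √c₂) * ε) := by
  have hres : ∀ k, decrement H x z k ≤ 1 / (4 * (1 + δ₀)) → δ₁ ≤ 1 →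
      (subdifferential (Df ∩ DR) (fun u => f u + R u) (z k)).Nonempty ∧
      subgradientResidual Df f DR R (H (x k)) (z k) ≤ 163 * (decrement H x z k + √δ₁) := by
    intro k hk hδ₁
    obtain ⟨ν, hs, hν⟩ := hip.stopping k
    have hν' := hν.trans (mul_le_of_le_one_left (weightedNorm_nonneg _ _) h4'.le)
    exact ho.subgradientResidual_le hsc (hX k) hν' hs hk hδ₁
  refine ⟨?_, hres, ?_⟩
  · rintro δ h3 h4δ hδ rfl
    have hrec := hip.decrementRecursion hsc ho hX h3 h4 h4δ hδ
    refine ⟨fun k hk => ?_, fun ε hε hε' h0 => ⟨fun hδ₂ => hrec.linear_rate h0 hε hε' hδ₂.le,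
      hrec.superlinear_rate h0 hε hε', hrec.quadratic_rate h0 hε hε'⟩⟩
    have hlam := hrec.nonneg k
    linarith [hrec.succ_le hk, sq_nonneg (decrement H x z k), mul_nonneg ho.delta0_nonneg hlam]
  · intro c₁ c₂ ε hε k hk hk' hδ₁ hδ₁'
    refine (hres k (hk.trans hk') (hδ₁.trans hδ₁')).2.trans ?_
    have hsqrt : √δ₁ ≤ √c₂ * ε :=
      (Real.sqrt_le_sqrt hδ₁).trans_eq (by rw [Real.sqrt_mul' _ (sq_nonneg ε), Real.sqrt_sq hε.le])
    linarith

theorem theorem4p4 :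
    -- absolute constants of the two `O`-bounds; `K c₁ c₂` depends on the constants in the
    -- hypotheses `λ_k ≤ c₁ ε` and `δ₁ ≤ c₂ ε²` only
    ∃ (C : ℝ) (K : ℝ → ℝ → ℝ), 0 < C ∧ (∀ c₁ c₂ : ℝ, 0 < c₁ → 0 < c₂ → 0 < K c₁ c₂) ∧
    ∀ (p : ℕ) (Df : Set (Vec p)) (f : Vec p → ℝ) (DR : Set (Vec p)) (R : Vec p → ℝ)
      (X : Set (Vec p)) (ftil : Vec p → ℝ) (g : Vec p → Vec p) (H : Vec p → Op p)
      (δ₀ δ₁ δ₂ δ₃ δ₄ : ℝ) (x z : ℕ → Vec p),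
      ProperClosedConvex Df f → StandardSelfConcordant Df f → ProperClosedConvex DR R →
      LocalInexactOracle Df f X ftil g H δ₀ δ₁ δ₂ δ₃ →
      0 ≤ δ₄ → δ₄ < 1 →
      IsDampedIPNA DR R g H δ₀ δ₄ x z →
      x 0 ∈ Df ∩ DR → (∀ k, x k ∈ X) →
      -- the one-step estimate and the local convergence rates
      (∀ δ : ℝ, δ₃ ≤ δ → δ₄ ≤ δ → δ ≤ 1 / 100 → δ₀ = δ →
        (∀ k, decrement H x z k ≤ 1 / 20 →
          decrement H x z (k + 1) ≤
            (41 * decrement H x z k ^ 2 + 125 * δ * decrement H x z k + 21 * δ₂) / 10) ∧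
        (∀ ε : ℝ, 0 < ε → ε < 1 / 20 → decrement H x z 0 ≤ 1 / 20 →
          -- linear rate
          (δ₂ = 5 * ε / 32 →
            decrement H x z ⌊Real.log (1 / ε)⌋₊ ≤ ε) ∧
          -- superlinear rate
          (δ ≤ 1 / 4 * (3 / 5 : ℝ) ^ Real.log (1 / ε) →
            δ₂ ≤ 37 / 20 * (11 / 50 : ℝ) ^ Real.log (1 / ε) →
            decrement H x z ⌊Real.logb (3 / 2) (Real.log (1 / ε))⌋₊ ≤ ε) ∧
          -- quadratic rate
          (δ ≤ 1 / 10 * (19 / 50 : ℝ) ^ Real.log (1 / ε) →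
            δ₂ ≤ 1 / 5 * (13 / 50 : ℝ) ^ Real.log (1 / ε) →
            decrement H x z ⌊Real.logb 2 (Real.log (1 / ε))⌋₊ ≤ ε))) ∧
      -- the subgradient residual
      (∀ k, decrement H x z k ≤ 1 / (4 * (1 + δ₀)) → δ₁ ≤ 1 →
        (subdifferential (Df ∩ DR) (fun u => f u + R u) (z k)).Nonempty ∧
        subgradientResidual Df f DR R (H (x k)) (z k) ≤ C * (decrement H x z k + √δ₁)) ∧
      (∀ c₁ c₂ ε : ℝ, 0 < c₁ → 0 < c₂ → 0 < ε → ∀ k,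
        decrement H x z k ≤ c₁ * ε → c₁ * ε ≤ 1 / (4 * (1 + δ₀)) →
        δ₁ ≤ c₂ * ε ^ 2 → c₂ * ε ^ 2 ≤ 1 →
        subgradientResidual Df f DR R (H (x k)) (z k) ≤ K c₁ c₂ * ε) :=
  ⟨163, fun c₁ c₂ => 163 * (c₁ + √c₂), by norm_num, fun c₁ c₂ hc₁ _ => by positivity,
    fun _ _ _ _ _ _ _ _ _ _ _ _ _ _ _ _ _ hsc _ ho h4 h4' hip _ hX =>
      (theorem4p4_general hsc ho h4 h4' hip hX).imp_right
        (.imp_right fun h c₁ c₂ ε _ _ => h c₁ c₂ ε)⟩
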